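/- **Conventions.** Let $M$ be a smooth manifold (Hausdorff, second countable, finite-dimensional), possibly with boundary, and let $I=[0,1]$. For $A\subseteq X\subseteq M\times I^k$ put $\mathrm{Cyl}(X,A):=X\times\{0\}\,\cup\,A\times I\subseteq X\times I\subseteq M\times I^{k+1}$. *Manifolds with cylinders* over $M$ are the subsets of $M\times I^k$ ($k\ge 0$) obtained inductively as follows: every closed neat submanifold of $M$ (including $\emptyset$ and $M$) is one, with $k=0$; if $X,A\subseteq M\times I^k$ are manifolds with cylinders and $A\subseteq X$, then so is $\mathrm{Cyl}(X,A)$, and so is $\mathrm{Cyl}(X,A)\cup D\times\{1\}$ for every manifold with cylinders $D\subseteq M\times I^k$ with $A\subseteq D$. (A submanifold $N$ is neat if $\partial N=N\cap\partial M$ and $N$ is transverse to $\partial M$; for $\partial M=\emptyset$ the closed neat submanifolds are the closed embedded submanifolds without boundary.) A *pair of manifolds with cylinders* $(X,A)$ consists of two manifolds with cylinders $A\subseteq X\subseteq M\times I^k$ over the same $M$. Let $Y$ be a topological space, $V^\bullet=(V^q)_{q\in\mathbb Z}$ a graded real vector space, $n\in\mathbb Z$, and $\kappa_n\in C^n(Y;V^\bullet)=\prod_{p+q=n}C^p(Y;V^q)$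 a singular cocycle. For a subset $S\subseteq M\times I^k$ with projection $\pi:S\to M$, let $C^n(S;V^\bullet)=\prod_{p+q=n}C^p(S;V^q)$ denote the smooth singular cochains of $S$, i.e. the cochains on those singular simplices of $S$ that are smooth as maps to $M\times\mathbb R^k$. A *differential function* $(f,h,\pi^*\omega):S\to(Y,\kappa_n)$ consists of a continuous map $f:S\to Y$, a cochain $h\in C^{n-1}(S;V^\bullet)$ and a closed form $\omega\in\Omega^n_{cl}(M;V^\bullet)=\prod_{p+q=n}\Omega^p_{cl}(M;V^q)$ such that $$\delta h=\chi(\pi^*\omega)-f^*\kappa_n ,$$ where $\chi(\pi^*\omega)$ is the cochain which integrates $\pi^*\omega$ over smooth simplices, and $f^*\kappa_n$ is evaluated on smooth simplices. (Forms with values in $V^q$ are assumed to take values, locally, in a finite-dimensional subspace.) A differential function on $X\times I$ with curvature pulled back from the base is a homotopy of differential functions on $X$. **Lemma 4.1 (HEP).** Let $(X,A)$ be a pair of manifolds with cylinders. Then the homotopy extension property holds for differential functions: for every differential function $(f,h,\pi^*\omega):\mathrm{Cyl}(X,A)\to(Y,\kappa_n)$ there is a homotopy $(F,H,\pi^*\omega):X\times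 I\to(Y,\kappa_n)$, with the same form $\omega$ on $M$, which extends it, i.e. $F|_{\mathrm{Cyl}(X,A)}=f$ and $H|_{\mathrm{Cyl}(X,A)}=h$. -/

import Mathlib

open Set MeasureTheory
open scoped Manifold ContDiff

noncomputable section

namespace DiffHEP

/-! ### Graded singular cochains -/

/-- Cochains of total degree `n` with values in the graded vector space `V`, on a graded set of
simplices `Simp`: the product over all `p + q = n` of the functions `Simp p → V q`. -/
def Cochain (Simp : ℕ → Type*) (V : ℤ → Type*) (n : ℤ) : Type _ :=
  ∀ (p : ℕ) (q : ℤ), (p : ℤ) + q = n → Simp p → V q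

/-- The coboundary `(δ c)(σ) = ∑ i, (-1) ^ i • c (d_i σ)` with respect to the face maps `face`. -/
def coboundary {Simp : ℕ → Type*} {V : ℤ → Type*} [∀ q, AddCommGroup (V q)]
    (face : ∀ p : ℕ, Fin (p + 2) → Simp (p + 1) → Simp p) {n : ℤ} (c : Cochain Simp V n) :
    Cochain Simp V (n + 1)
  | 0, _, _, _ => 0
  | p + 1, q, hpq, σ =>
      ∑ i : Fin (p + 2), ((-1 : ℤ) ^ (i : ℕ)) • c p q (by push_cast at hpq; omega) (face p i σ)

/-- The inclusion of the `i`-th face of the standard `(p + 1)`-simplex. -/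
def faceIncl (p : ℕ) (i : Fin (p + 2)) :
    C(stdSimplex ℝ (Fin (p + 1)), stdSimplex ℝ (Fin (p + 2))) :=
  ⟨stdSimplex.map i.succAbove, stdSimplex.continuous_map _⟩

/-- Singular `p`-simplices of a topological space. -/
abbrev SingularSimplex (Y : Type*) [TopologicalSpace Y] (p : ℕ) : Type _ :=
  C(stdSimplex ℝ (Fin (p + 1)), Y)

/-- The faces of a singular simplex. -/
def singularFace (Y : Type*) [TopologicalSpace Y] (p : ℕ) (i : Fin (p + 2))
    (σ : SingularSimplex Y (p + 1)) : SingularSimplex Y p :=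
  σ.comp (faceIncl p i)

/-- `Cⁿ(Y; V)`: singular cochains of total degree `n` of the topological space `Y`. -/
abbrev SingularCochain (Y : Type*) [TopologicalSpace Y] (V : ℤ → Type*) (n : ℤ) : Type _ :=
  Cochain (SingularSimplex Y) V n

/-- The singular cocycles: `δ κ = 0`. -/
def IsSingularCocycle {Y : Type*} [TopologicalSpace Y] {V : ℤ → Type*} [∀ q, AddCommGroup (V q)]
    {n : ℤ} (κ : SingularCochain Y V n) : Prop :=
  ∀ (p : ℕ) (q : ℤ) (hpq : (p : ℤ) + q = n + 1) (σ : SingularSimplex Y p),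
    coboundary (singularFace Y) κ p q hpq σ = 0

/-! ### Cartesian coordinates on the standard simplex -/

/-- The simplex `{t ∈ ℝᵖ | t_i ≥ 0, ∑ t_i ≤ 1}` with vertices `0, e_1, …, e_p`. -/
def corner (p : ℕ) : Set (Fin p → ℝ) :=
  {t | (∀ i, 0 ≤ t i) ∧ ∑ i, t i ≤ 1}

/-- Barycentric coordinates `(1 - ∑ t_i, t_1, …, t_p)`. -/
def baryVec {p : ℕ} (t : Fin p → ℝ) : Fin (p + 1) → ℝ :=
  Fin.cons (1 - ∑ i, t i) t

theorem baryVec_mem {p : ℕ} {t : Fin p → ℝ} (ht : t ∈ corner p) :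
    baryVec t ∈ stdSimplex ℝ (Fin (p + 1)) := by
  refine ⟨fun i => ?_, ?_⟩
  · refine Fin.cases ?_ (fun j => ?_) i
    · simpa [baryVec] using ht.2
    · simpa [baryVec] using ht.1 j
  · simp [baryVec, Fin.sum_univ_succ]

open Classical in
/-- The affine bijection from `corner p` onto the standard simplex that preserves the order of the
vertices (with the value `vertex 0` outside `corner p`). -/
def bary (p : ℕ) (t : Fin p → ℝ) : stdSimplex ℝ (Fin (p + 1)) :=
  if ht : t ∈ corner p then ⟨baryVec t, baryVec_mem ht⟩ else stdSimplex.vertex 0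

theorem bary_of_mem {p : ℕ} {t : Fin p → ℝ} (ht : t ∈ corner p) :
    bary p t = ⟨baryVec t, baryVec_mem ht⟩ := dif_pos ht

/-- The face inclusion in Cartesian coordinates. -/
def cornerFace (p : ℕ) (i : Fin (p + 2)) (t : Fin p → ℝ) : Fin (p + 1) → ℝ :=
  fun j => FunOnFinite.linearMap ℝ ℝ i.succAbove (baryVec t) j.succ

theorem cornerFace_mem {p : ℕ} (i : Fin (p + 2)) {t : Fin p → ℝ} (ht : t ∈ corner p) :
    cornerFace p i t ∈ corner (p + 1) := by
  have h := stdSimplex.image_linearMap (S := ℝ) i.succAbove ⟨_, baryVec_mem ht, rfl⟩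
  refine ⟨fun j => h.1 _, ?_⟩
  have h2 := h.2
  rw [Fin.sum_univ_succ] at h2
  have h0 := h.1 0
  simp only [cornerFace]
  linarith

theorem faceIncl_bary {p : ℕ} (i : Fin (p + 2)) {t : Fin p → ℝ} (ht : t ∈ corner p) :
    faceIncl p i (bary p t) = bary (p + 1) (cornerFace p i t) := by
  have h := stdSimplex.image_linearMap (S := ℝ) i.succAbove ⟨_, baryVec_mem ht, rfl⟩
  rw [bary_of_mem ht, bary_of_mem (cornerFace_mem i ht)]
  apply Subtype.ext
  change FunOnFinite.linearMap ℝ ℝ i.succAbove (baryVec t) = baryVec (cornerFace p i t)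
  funext j
  refine Fin.cases ?_ (fun j => ?_) j
  · have h2 := h.2
    rw [Fin.sum_univ_succ] at h2
    simp only [baryVec, Fin.cons_zero, cornerFace]
    simp only [baryVec] at h2
    linarith
  · simp [baryVec, cornerFace]

theorem contDiff_cornerFace (p : ℕ) (i : Fin (p + 2)) : ContDiff ℝ ∞ (cornerFace p i) := by
  have h1 : ContDiff ℝ ∞ (baryVec : (Fin p → ℝ) → Fin (p + 1) → ℝ) := by
    rw [contDiff_pi]
    intro j
    refine Fin.cases ?_ (fun j => ?_) j
    · simp only [baryVec, Fin.cons_zero]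
      fun_prop
    · simp only [baryVec, Fin.cons_succ]
      fun_prop
  rw [contDiff_pi]
  intro j
  have h2 : ContDiff ℝ ∞ (fun v => FunOnFinite.linearMap ℝ ℝ i.succAbove v j.succ) :=
    (LinearMap.toContinuousLinearMap
      (LinearMap.proj j.succ ∘ₗ FunOnFinite.linearMap ℝ ℝ i.succAbove)).contDiff
  exact h2.comp h1

/-! ### Differential forms with values in a real vector space -/

theorem continuous_multilinear {E : Type*} [NormedAddCommGroup E] [NormedSpace ℝ E]
    [FiniteDimensional ℝ E] {p : ℕ} (f : MultilinearMap ℝ (fun _ : Fin p => E) ℝ) :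
    Continuous f := by
  classical
  let b := Module.finBasis ℝ E
  have h : ∀ v : Fin p → E, f v = ∑ r : (∀ _ : Fin p, Fin (Module.finrank ℝ E)),
      (∏ i, b.coord (r i) (v i)) * f (fun i => b (r i)) := by
    intro v
    conv_lhs => rw [show v = fun i => ∑ j, b.coord j (v i) • b j from
      funext fun i => (b.sum_repr (v i)).symm]
    rw [f.map_sum]
    exact Finset.sum_congr rfl fun r _ => by rw [f.map_smul_univ, smul_eq_mul]
  rw [show (f : (Fin p → E) → ℝ) = _ from funext h]
  refine continuous_finsetSum _ fun r _ => (continuous_finsetProd _ fun i _ => ?_).mul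
    continuous_const
  exact (LinearMap.continuous_of_finiteDimensional (b.coord (r i))).comp (continuous_apply i)

section Forms

variable {E : Type*} [NormedAddCommGroup E] [NormedSpace ℝ E]
  {H : Type*} [TopologicalSpace H] (I : ModelWithCorners ℝ E H)
  {M : Type*} [TopologicalSpace M] [ChartedSpace H M]

/-- The expression of a real `p`-form in the preferred chart at `x₀` (its pull-back to the model
space under the inverse of the chart). -/
def formInChart {p : ℕ} (η : ∀ x : M, TangentSpace I x [⋀^Fin p]→L[ℝ] ℝ) (x₀ : M) :
    E → E [⋀^Fin p]→L[ℝ] ℝ :=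
  fun y => (η ((extChartAt I x₀).symm y)).compContinuousLinearMap
    (mfderivWithin 𝓘(ℝ, E) I (extChartAt I x₀).symm (range I) y)

/-- A real form is smooth if all of its chart expressions are. -/
def IsSmoothForm {p : ℕ} (η : ∀ x : M, TangentSpace I x [⋀^Fin p]→L[ℝ] ℝ) : Prop :=
  ∀ x₀ : M, ContDiffOn ℝ ∞ (formInChart I η x₀) (extChartAt I x₀).target

/-- A real form is closed if the exterior derivatives of all its chart expressions vanish. -/
def IsClosedForm {p : ℕ} (η : ∀ x : M, TangentSpace I x [⋀^Fin p]→L[ℝ] ℝ) : Prop :=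
  ∀ x₀ : M, ∀ y ∈ (extChartAt I x₀).target,
    extDerivWithin (formInChart I η x₀) (range I) y = 0

variable [FiniteDimensional ℝ E]

/-- The real component `ℓ ∘ η` of an alternating map with values in a real vector space. -/
def formComponent {p : ℕ} {W : Type*} [AddCommGroup W] [Module ℝ W] {x : M}
    (η : TangentSpace I x [⋀^Fin p]→ₗ[ℝ] W) (ℓ : W →ₗ[ℝ] ℝ) : TangentSpace I x [⋀^Fin p]→L[ℝ] ℝ :=
  { ℓ.compAlternatingMap η with
    cont := by
      exact continuous_multilinear (E := E) (ℓ.compAlternatingMap η).toMultilinearMap }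

variable (M) in
/-- Closed smooth `p`-forms on `M` with values in the real vector space `W`. No topology on `W` is
needed: locally such a form takes its values in a finite-dimensional subspace of `W`, and there
smoothness and closedness are tested on the components. If `W` is finite-dimensional these are all
the closed smooth forms with values in `W`. -/
structure ClosedForm (p : ℕ) (W : Type*) [AddCommGroup W] [Module ℝ W] where
  /-- The value of the form at a point. -/
  toFun : ∀ x : M, TangentSpace I x [⋀^Fin p]→ₗ[ℝ] W
  locally_finite : ∀ x₀ : M, ∃ U : Set M, IsOpen U ∧ x₀ ∈ U ∧ ∃ F : Submodule ℝ W,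
    FiniteDimensional ℝ F ∧ ∀ x ∈ U, ∀ v, toFun x v ∈ F
  smooth : ∀ ℓ : W →ₗ[ℝ] ℝ, IsSmoothForm I (fun x => formComponent I (toFun x) ℓ)
  closed : ∀ ℓ : W →ₗ[ℝ] ℝ, IsClosedForm I (fun x => formComponent I (toFun x) ℓ)

open Classical in
/-- The integral over `s` of a vector-valued function: the vector `w` (unique, if it exists) with
`ℓ w = ∫ ℓ ∘ g` for all linear functionals `ℓ`. It exists if `g` is integrable with values in a
finite-dimensional subspace. -/
def vectorIntegral {p : ℕ} {W : Type*} [AddCommGroup W] [Module ℝ W]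
    (s : Set (Fin p → ℝ)) (g : (Fin p → ℝ) → W) : W :=
  if h : ∃ w : W, ∀ ℓ : W →ₗ[ℝ] ℝ, ℓ w = ∫ t in s, ℓ (g t) then h.choose else 0

/-- The integral of a form on `M` over a simplex of `M`, that is, the integral over `corner p` of
`η(∂σ/∂t_1, …, ∂σ/∂t_p) dt_1 ⋯ dt_p`. -/
def integralForm {p : ℕ} {W : Type*} [AddCommGroup W] [Module ℝ W]
    (η : ClosedForm I M p W) (σ : stdSimplex ℝ (Fin (p + 1)) → M) : W :=
  vectorIntegral (corner p) fun t => η.toFun (σ (bary p t)) fun i =>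
    mfderivWithin 𝓘(ℝ, Fin p → ℝ) I (fun t => σ (bary p t)) (corner p) t
      (Pi.single i 1 : Fin p → ℝ)

end Forms

/-! ### Manifolds, neat submanifolds, manifolds with cylinders -/

/-- The model of manifolds without boundary, or of manifolds with boundary: the range of the model
is the whole vector space or a closed half-space. -/
def IsBoundaryModel {E : Type*} [NormedAddCommGroup E] [NormedSpace ℝ E]
    {H : Type*} [TopologicalSpace H] (I : ModelWithCorners ℝ E H) : Prop :=
  range I = univ ∨ ∃ ℓ : E →L[ℝ] ℝ, ℓ ≠ 0 ∧ range I = {y | 0 ≤ ℓ y}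

/-- `Cyl(X, A) = X × {0} ∪ A × [0, 1]`; the coordinate of the new interval comes last. -/
def cyl {M : Type*} {k : ℕ} (X A : Set (M × (Fin k → ℝ))) : Set (M × (Fin (k + 1) → ℝ)) :=
  {x | ((x.1, Fin.init x.2) ∈ X ∧ x.2 (Fin.last k) = 0) ∨
    ((x.1, Fin.init x.2) ∈ A ∧ x.2 (Fin.last k) ∈ Icc (0 : ℝ) 1)}

/-- `X × [0, 1]`. -/
def prodI {M : Type*} {k : ℕ} (X : Set (M × (Fin k → ℝ))) : Set (M × (Fin (k + 1) → ℝ)) :=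
  {x | (x.1, Fin.init x.2) ∈ X ∧ x.2 (Fin.last k) ∈ Icc (0 : ℝ) 1}

/-- `X × {1}`. -/
def top {M : Type*} {k : ℕ} (X : Set (M × (Fin k → ℝ))) : Set (M × (Fin (k + 1) → ℝ)) :=
  {x | (x.1, Fin.init x.2) ∈ X ∧ x.2 (Fin.last k) = 1}

theorem cyl_subset_prodI {M : Type*} {k : ℕ} {X A : Set (M × (Fin k → ℝ))} (hAX : A ⊆ X) :
    cyl X A ⊆ prodI X := by
  rintro x (⟨hx, h0⟩ | ⟨hx, h1⟩)
  · exact ⟨hx, by simp [h0]⟩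
  · exact ⟨hAX hx, h1⟩

section Spaces

variable {E : Type*} [NormedAddCommGroup E] [NormedSpace ℝ E]
  {H : Type*} [TopologicalSpace H] (I : ModelWithCorners ℝ E H)
  {M : Type*} [TopologicalSpace M] [ChartedSpace H M]

/-- Closed neat submanifolds: around each of its points `x`, in a suitable chart, `N` is the
affine subspace through `x` with direction `L`, which at a point of the boundary of `M` is
transverse to the boundary. If `M` has no boundary these are the closed embedded submanifolds
without boundary. -/
def IsNeatSubmanifold (N : Set M) : Prop :=
  IsClosed N ∧ ∀ x ∈ N, ∃ φ ∈ IsManifold.maximalAtlas I ∞ M, x ∈ φ.source ∧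
    ∃ L : Submodule ℝ E,
      (∀ y ∈ φ.source, y ∈ N ↔ φ.extend I y - φ.extend I x ∈ L) ∧
      (φ.extend I x ∈ frontier (range I) →
        ∃ v ∈ L, φ.extend I x + v ∈ interior (range I))

/-- The manifolds with cylinders over `M`, as subspaces of `M × [0, 1]ᵏ`: they are obtained from
neat submanifolds of `M` (in particular `M` itself and `∅`) by iterating the construction of the
cylinder `Cyl(X, A)` of a pair. The last clause also admits `Cyl(X, A) ∪ D × {1}`, where `D ⊇ A` is
glued to the other end of the cylinder `A × [0, 1]`; so `X ∪ A × {1} ⊆ Cyl(X, A)` and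
`Cyl(X, A) ∪ X × {1} ⊆ X × [0, 1]` are manifolds with cylinders. -/
inductive IsManifoldWithCylinders : ∀ k : ℕ, Set (M × (Fin k → ℝ)) → Prop
  | base (N : Set M) (hN : IsNeatSubmanifold I N) :
      IsManifoldWithCylinders 0 {x | x.1 ∈ N}
  | cyl (k : ℕ) (X A : Set (M × (Fin k → ℝ))) (hX : IsManifoldWithCylinders k X)
      (hA : IsManifoldWithCylinders k A) (hAX : A ⊆ X) :
      IsManifoldWithCylinders (k + 1) (cyl X A)
  | cylTop (k : ℕ) (X A D : Set (M × (Fin k → ℝ))) (hX : IsManifoldWithCylinders k X)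
      (hA : IsManifoldWithCylinders k A) (hD : IsManifoldWithCylinders k D)
      (hAX : A ⊆ X) (hAD : A ⊆ D) :
      IsManifoldWithCylinders (k + 1) (cyl X A ∪ top D)

/-! ### Smooth singular cochains and differential functions -/

/-- Smooth singular `p`-simplices of a subset `S` of `M × ℝᵏ`. -/
@[ext]
structure SmoothSimplex {k : ℕ} (S : Set (M × (Fin k → ℝ))) (p : ℕ) where
  /-- The underlying singular simplex. -/
  toMap : SingularSimplex S p
  smooth_fst : ContMDiffOn 𝓘(ℝ, Fin p → ℝ) I ∞ (fun t => (toMap (bary p t)).1.1) (corner p)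
  smooth_snd : ContDiffOn ℝ ∞ (fun t => (toMap (bary p t)).1.2) (corner p)

variable {k : ℕ}

/-- The faces of a smooth simplex. -/
def smoothFace (S : Set (M × (Fin k → ℝ))) (p : ℕ) (i : Fin (p + 2))
    (σ : SmoothSimplex I S (p + 1)) : SmoothSimplex I S p where
  toMap := singularFace S p i σ.toMap
  smooth_fst := by
    refine (σ.smooth_fst.comp (contDiff_cornerFace p i).contMDiff.contMDiffOn
      (fun t ht => cornerFace_mem i ht)).congr fun t ht => ?_
    change (σ.toMap (faceIncl p i (bary p t))).1.1 = _
    rw [faceIncl_bary i ht]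
    rfl
  smooth_snd := by
    refine (σ.smooth_snd.comp (contDiff_cornerFace p i).contDiffOn
      (fun t ht => cornerFace_mem i ht)).congr fun t ht => ?_
    change (σ.toMap (faceIncl p i (bary p t))).1.2 = _
    rw [faceIncl_bary i ht]
    rfl

/-- A smooth simplex of `S`, seen in a larger subset. -/
def SmoothSimplex.incl {S T : Set (M × (Fin k → ℝ))} (hST : S ⊆ T) {p : ℕ}
    (σ : SmoothSimplex I S p) : SmoothSimplex I T p where
  toMap := (ContinuousMap.inclusion hST).comp σ.toMap
  smooth_fst := σ.smooth_fst
  smooth_snd := σ.smooth_snd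

/-- `Cⁿ(S; V)`: smooth singular cochains of total degree `n`. -/
abbrev SmoothCochain (S : Set (M × (Fin k → ℝ))) (V : ℤ → Type*) (n : ℤ) : Type _ :=
  Cochain (SmoothSimplex I S) V n

variable [FiniteDimensional ℝ E]

variable (M) in
/-- `Ωⁿ_cl(M; V)`: closed forms of total degree `n` with values in the graded vector space `V`. -/
abbrev ClosedGradedForm (V : ℤ → Type*) [∀ q, AddCommGroup (V q)] [∀ q, Module ℝ (V q)]
    (n : ℤ) : Type _ :=
  ∀ (p : ℕ) (q : ℤ), (p : ℤ) + q = n → ClosedForm I M p (V q)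

/-- `χ(π^* η)`, for `π : S → M` the projection: the smooth singular cochain which integrates the
pull-back of `η` over the smooth simplices of `S`. -/
def chi {V : ℤ → Type*} [∀ q, AddCommGroup (V q)] [∀ q, Module ℝ (V q)] {n : ℤ}
    (S : Set (M × (Fin k → ℝ))) (η : ClosedGradedForm I M V n) : SmoothCochain I S V n :=
  fun p q hpq σ => integralForm I (η p q hpq) fun x => (σ.toMap x).1.1

/-- `f^* κ`, as a smooth singular cochain. -/
def pullbackCochain {Y : Type*} [TopologicalSpace Y] {V : ℤ → Type*} {n : ℤ}
    {S : Set (M × (Fin k → ℝ))} (f : C(S, Y)) (κ : SingularCochain Y V n) :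
    SmoothCochain I S V n :=
  fun p q hpq σ => κ p q hpq (f.comp σ.toMap)

/-- Differential functions `(f, h, π^* η) : S → (Y, κ)`, where the curvature is the pull-back of
a closed form `η` on the base `M`. For `S = M` these are the differential functions
`(f, h, η) : M → (Y, κ)`, and for `S = X × [0, 1]` the homotopies of differential functions
on `X`. -/
structure DifferentialFunction {Y : Type*} [TopologicalSpace Y] {V : ℤ → Type*}
    [∀ q, AddCommGroup (V q)] [∀ q, Module ℝ (V q)] {n : ℤ}
    (S : Set (M × (Fin k → ℝ))) (κ : SingularCochain Y V n) where
  /-- The continuous map. -/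
  f : C(S, Y)
  /-- The cochain. -/
  h : SmoothCochain I S V (n - 1)
  /-- The form on the base whose pull-back is the curvature. -/
  curv : ClosedGradedForm I M V n
  coboundary_eq : ∀ (p : ℕ) (q : ℤ) (hpq : (p : ℤ) + q = n) (σ : SmoothSimplex I S p),
    coboundary (smoothFace I S) h p q (by omega) σ =
      chi I S curv p q hpq σ - pullbackCochain I f κ p q hpq σ

end Spaces

end DiffHEP

end

/-
Neat submanifolds are neighbourhood extensors (ANE's); since this property is local and passes to
unions `A ∪ B` of closed sets when `A`, `B` and `A ∩ B` have it, all manifolds with cylinders are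
neighbourhood extensors. Hence `Cyl(X, A)` is a retract of a neighbourhood in `X × I`, and squeezing
the cylinder coordinate by a Urysohn function turns this into a way of extending `f` to a map `F` on
all of `X × I`.

For the cochain, contract the last coordinate to `0`: this preserves `Cyl(X, A)`, and in the end
pushes `X × I` into it. Extend `h` by zero to a cochain `e`. Then `r = χ(π^*ω) - F^*κ - δe` vanishes
on `Cyl(X, A)`. It is a cocycle: `χ(π^*ω)` is unchanged by the contraction, so its coboundary may be
computed on `Cyl(X, A)`, where it is `δδh + δf^*κ = 0`. The prism operator `P` of the contraction
therefore satisfies `δPr = r`, and `Pr` vanishes on `Cyl(X, A)`; so `H = e + Pr` extends `h`.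
-/

open Topology

namespace DiffHEP

/-! ### Neighbourhood extensors -/

section Extensor

variable {Z P Q : Type*} [TopologicalSpace Z] [TopologicalSpace P] [TopologicalSpace Q]

/-- The subspace `S` is a neighbourhood extensor for the space `Z`: a map to `S` from a closed
subset of `Z` extends to a neighbourhood of that subset. -/
def IsNbhdExtensor (Z : Type*) [TopologicalSpace Z] (S : Set P) : Prop :=
  ∀ (C : Set Z) (f : Z → P), IsClosed C → ContinuousOn f C → MapsTo f C S →
    ∃ U ∈ 𝓝ˢ C, ∃ g : Z → P, ContinuousOn g U ∧ MapsTo g U S ∧ EqOn g f C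

theorem IsNbhdExtensor.exists_isClosed [NormalSpace Z] {S : Set P} (hS : IsNbhdExtensor Z S)
    {C : Set Z} {f : Z → P} (hC : IsClosed C) (hf : ContinuousOn f C) (hfS : MapsTo f C S) :
    ∃ K ∈ 𝓝ˢ C, IsClosed K ∧ ∃ g : Z → P, ContinuousOn g K ∧ MapsTo g K S ∧ EqOn g f C := by
  obtain ⟨U, hU, g, hg, hgS, hgf⟩ := hS C f hC hf hfS
  obtain ⟨K, hK, hKc, hKU⟩ := exists_mem_nhdsSet_isClosed_subset hU hC
  exact ⟨K, hK, hKc, g, hg.mono hKU, hgS.mono_left hKU, hgf⟩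

theorem isNbhdExtensor_empty : IsNbhdExtensor Z (∅ : Set P) := by
  intro C f _ _ hf
  obtain rfl : C = ∅ := eq_empty_of_forall_notMem fun z hz => hf hz
  exact ⟨∅, mem_nhdsSet_empty, f, continuousOn_empty f, mapsTo_empty f _, eqOn_empty _ _⟩

theorem isNbhdExtensor_univ.{u, v} {Z : Type u} [TopologicalSpace Z] [NormalSpace Z]
    {P : Type v} [TopologicalSpace P] [TietzeExtension.{u, v} P] :
    IsNbhdExtensor Z (univ : Set P) := by
  intro C f hC hf _
  obtain ⟨g, hg⟩ := ContinuousMap.exists_restrict_eq hC ⟨C.domRestrict f, hf.domRestrict⟩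
  exact ⟨univ, Filter.univ_mem, g, g.continuous.continuousOn, mapsTo_univ _ _,
    fun z hz => congrArg (fun F => F ⟨z, hz⟩) hg⟩

theorem IsNbhdExtensor.retract {S : Set P} {T : Set Q} (hT : IsNbhdExtensor Z T) {i : P → Q}
    {r : Q → P} (hi : ContinuousOn i S) (hiT : MapsTo i S T) (hr : ContinuousOn r T)
    (hrS : MapsTo r T S) (hri : LeftInvOn r i S) : IsNbhdExtensor Z S := by
  intro C f hC hf hfS
  obtain ⟨U, hU, g, hg, hgT, hgf⟩ := hT C (i ∘ f) hC (hi.comp hf hfS) (hiT.comp hfS)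
  refine ⟨U, hU, r ∘ g, hr.comp hg hgT, hrS.comp hgT, fun z hz => ?_⟩
  rw [Function.comp_apply, hgf hz]
  exact hri (hfS hz)

theorem IsNbhdExtensor.preimage_homeomorph {T : Set Q} (hT : IsNbhdExtensor Z T) (e : P ≃ₜ Q) :
    IsNbhdExtensor Z (e ⁻¹' T) :=
  hT.retract e.continuous.continuousOn (mapsTo_preimage e T) e.symm.continuous.continuousOn
    (fun y hy => by simpa using hy) fun x _ => e.symm_apply_apply x

theorem IsNbhdExtensor.inter_isOpen {S O : Set P} (hS : IsNbhdExtensor Z S) (hO : IsOpen O) :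
    IsNbhdExtensor Z (S ∩ O) := by
  intro C f hC hf hfS
  obtain ⟨U, hU, g, hg, hgS, hgf⟩ := hS C f hC hf fun z hz => (hfS hz).1
  obtain ⟨V, hV, hCV, hVU⟩ := mem_nhdsSet_iff_exists.1 hU
  have hVO : IsOpen (V ∩ g ⁻¹' O) := (hg.mono hVU).isOpen_inter_preimage hV hO
  refine ⟨V ∩ g ⁻¹' O, hVO.mem_nhdsSet.2 fun z hz => ⟨hCV hz, ?_⟩, g,
    hg.mono fun z hz => hVU hz.1, fun z hz => ⟨hgS (hVU hz.1), hz.2⟩, hgf⟩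
  rw [mem_preimage, hgf hz]
  exact (hfS hz).2

theorem IsNbhdExtensor.prod {S : Set P} {T : Set Q} (hS : IsNbhdExtensor Z S)
    (hT : IsNbhdExtensor Z T) : IsNbhdExtensor Z (S ×ˢ T) := by
  intro C f hC hf hfST
  obtain ⟨U, hU, g, hg, hgS, hgf⟩ := hS C (fun z => (f z).1) hC hf.fst fun z hz => (hfST hz).1
  obtain ⟨V, hV, l, hl, hlT, hlf⟩ := hT C (fun z => (f z).2) hC hf.snd fun z hz => (hfST hz).2
  exact ⟨U ∩ V, Filter.inter_mem hU hV, fun z => (g z, l z),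
    (hg.mono inter_subset_left).prodMk (hl.mono inter_subset_right),
    fun z hz => ⟨hgS hz.1, hlT hz.2⟩, fun z hz => Prod.ext (hgf hz) (hlf hz)⟩

theorem isNbhdExtensor_Icc [NormalSpace Z] {a b : ℝ} (hab : a ≤ b) :
    IsNbhdExtensor Z (Icc a b) :=
  (isNbhdExtensor_univ (P := ℝ)).retract continuousOn_id (mapsTo_univ _ _)
    (continuous_subtype_val.comp continuous_projIcc).continuousOn
    (fun t _ => (projIcc a b hab t).2) fun t ht => by simp [projIcc_of_mem hab ht]

theorem isNbhdExtensor_singleton [NormalSpace Z] (a : ℝ) : IsNbhdExtensor Z ({a} : Set ℝ) := by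
  simpa using isNbhdExtensor_Icc (Z := Z) (le_refl a)

theorem exists_continuousOn_union {A B : Set Z} {f g : Z → P} {S : Set P} (hA : IsClosed A)
    (hB : IsClosed B) (hf : ContinuousOn f A) (hg : ContinuousOn g B) (hfS : MapsTo f A S)
    (hgS : MapsTo g B S) (hfg : EqOn f g (A ∩ B)) :
    ∃ h : Z → P, ContinuousOn h (A ∪ B) ∧ MapsTo h (A ∪ B) S ∧ EqOn h f A ∧ EqOn h g B := by
  classical
  have hhf : EqOn (A.piecewise f g) f A := piecewise_eqOn A f g
  have hhg : EqOn (A.piecewise f g) g B := fun z hz => by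
    by_cases hzA : z ∈ A
    · rw [hhf hzA, hfg ⟨hzA, hz⟩]
    · exact piecewise_eq_of_notMem A f g hzA
  exact ⟨A.piecewise f g, (hf.congr hhf).union_of_isClosed (hg.congr hhg) hA hB,
    (hfS.congr hhf.symm).union (hgS.congr hhg.symm), hhf, hhg⟩

end Extensor

/-! ### Unions of neighbourhood extensors -/

section Union

variable {Z P : Type*} [TopologicalSpace Z] [TopologicalSpace P]

theorem exists_isClosed_cover_inter_subset [CompletelyNormalSpace Z] {C₁ C₂ : Set Z}
    (h₁ : IsClosed C₁) (h₂ : IsClosed C₂) :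
    ∃ Z₁ Z₂ : Set Z, IsClosed Z₁ ∧ IsClosed Z₂ ∧ Z₁ ∪ Z₂ = univ ∧
      (C₁ ∪ C₂) ∩ Z₁ ⊆ C₁ ∧ (C₁ ∪ C₂) ∩ Z₂ ⊆ C₂ := by
  have hd₁ : Disjoint (closure (C₁ \ C₂)) (C₂ \ C₁) :=
    disjoint_sdiff_right.mono_left (closure_minimal sdiff_subset h₁)
  have hd₂ : Disjoint (C₁ \ C₂) (closure (C₂ \ C₁)) :=
    disjoint_sdiff_left.mono_right (closure_minimal sdiff_subset h₂)
  obtain ⟨U₁, U₂, hU₁, hU₂, hC₁, hC₂, hU⟩ :=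
    separatedNhds_iff_disjoint.2 (CompletelyNormalSpace.completely_normal hd₁ hd₂)
  refine ⟨U₂ᶜ, U₁ᶜ, hU₂.isClosed_compl, hU₁.isClosed_compl, ?_, ?_, ?_⟩
  · rw [← compl_inter, inter_comm, hU.inter_eq, compl_empty]
  · rintro z ⟨hz, hzU⟩
    by_contra hz₁
    exact hzU (hC₂ ⟨hz.resolve_left hz₁, hz₁⟩)
  · rintro z ⟨hz, hzU⟩
    by_contra hz₂
    exact hzU (hC₁ ⟨hz.resolve_right hz₂, hz₂⟩)

theorem IsNbhdExtensor.exists_extension_union_inter [NormalSpace Z] {S : Set P}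
    (hS : IsNbhdExtensor Z S) {C Z₀ : Set Z} (hC : IsClosed C) (hZ₀ : IsClosed Z₀) {f : Z → P}
    (hf : ContinuousOn f C) (hfS : MapsTo f (C ∩ Z₀) S) :
    ∃ K ∈ 𝓝ˢ (C ∩ Z₀), IsClosed K ∧ ∃ g : Z → P, ContinuousOn g (C ∪ K ∩ Z₀) ∧
      MapsTo g (K ∩ Z₀) S ∧ EqOn g f C := by
  obtain ⟨K, hK, hKc, g, hg, hgS, hgf⟩ :=
    hS.exists_isClosed (hC.inter hZ₀) (hf.mono inter_subset_left) hfS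
  obtain ⟨h, hh, -, hhf, hhg⟩ := exists_continuousOn_union hC (hKc.inter hZ₀) hf
    (hg.mono inter_subset_left) (mapsTo_univ _ _) (mapsTo_univ _ _)
    fun z hz => (hgf ⟨hz.1, hz.2.2⟩).symm
  exact ⟨K, hK, hKc, h, hh, (hgS.mono_left inter_subset_left).congr hhg.symm, hhf⟩

theorem union_compl_mem_nhdsSet {C K Z₀ : Set Z} (hZ₀ : IsClosed Z₀) (hK : K ∈ 𝓝ˢ (C ∩ Z₀)) :
    K ∪ Z₀ᶜ ∈ 𝓝ˢ C :=
  hZ₀.nhdsSet_le_sup C (Filter.union_mem_sup hK (Filter.mem_principal_self _))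

theorem exists_extension_of_eqOn_inter {S : Set P} {C Z₁ Z₂ K₁ K₂ : Set Z} (hZ₁ : IsClosed Z₁)
    (hZ₂ : IsClosed Z₂) (hZ : Z₁ ∪ Z₂ = univ) (hK₁ : IsClosed K₁) (hK₂ : IsClosed K₂)
    (hCK₁ : K₁ ∈ 𝓝ˢ (C ∩ Z₁)) (hCK₂ : K₂ ∈ 𝓝ˢ (C ∩ Z₂)) {f g₁ g₂ : Z → P}
    (hg₁ : ContinuousOn g₁ K₁) (hg₂ : ContinuousOn g₂ K₂) (hgS₁ : MapsTo g₁ K₁ S)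
    (hgS₂ : MapsTo g₂ K₂ S) (hg : EqOn g₁ g₂ ((K₁ ∩ Z₁) ∩ (K₂ ∩ Z₂)))
    (hf₁ : EqOn g₁ f (C ∩ Z₁)) (hf₂ : EqOn g₂ f (C ∩ Z₂)) :
    ∃ U ∈ 𝓝ˢ C, ∃ g : Z → P, ContinuousOn g U ∧ MapsTo g U S ∧ EqOn g f C := by
  obtain ⟨g, hgc, hgS, hgg₁, hgg₂⟩ := exists_continuousOn_union (hK₁.inter hZ₁) (hK₂.inter hZ₂)
    (hg₁.mono inter_subset_left) (hg₂.mono inter_subset_left) (hgS₁.mono_left inter_subset_left)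
    (hgS₂.mono_left inter_subset_left) hg
  have hcover : ∀ z, z ∈ Z₁ ∨ z ∈ Z₂ := eq_univ_iff_forall.1 hZ
  refine ⟨K₁ ∩ Z₁ ∪ K₂ ∩ Z₂, ?_, g, hgc, hgS, fun z hz => ?_⟩
  · filter_upwards [union_compl_mem_nhdsSet hZ₁ hCK₁, union_compl_mem_nhdsSet hZ₂ hCK₂] with z h₁ h₂
    exact (hcover z).imp (fun hz => ⟨h₁.resolve_right (not_not_intro hz), hz⟩)
      fun hz => ⟨h₂.resolve_right (not_not_intro hz), hz⟩
  · rcases hcover z with hz₁ | hz₂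
    · rw [hgg₁ ⟨subset_of_mem_nhdsSet hCK₁ ⟨hz, hz₁⟩, hz₁⟩, hf₁ ⟨hz, hz₁⟩]
    · rw [hgg₂ ⟨subset_of_mem_nhdsSet hCK₂ ⟨hz, hz₂⟩, hz₂⟩, hf₂ ⟨hz, hz₂⟩]

theorem exists_extension_of_isClosed_cover [NormalSpace Z] {S₁ S₂ : Set P}
    (hS₁ : IsNbhdExtensor Z S₁) (hS₂ : IsNbhdExtensor Z S₂) (hS : IsNbhdExtensor Z (S₁ ∩ S₂))
    {C Z₁ Z₂ : Set Z} (hC : IsClosed C) (hZ₁ : IsClosed Z₁) (hZ₂ : IsClosed Z₂)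
    (hZ : Z₁ ∪ Z₂ = univ) {f : Z → P} (hf : ContinuousOn f C) (hf₁ : MapsTo f (C ∩ Z₁) S₁)
    (hf₂ : MapsTo f (C ∩ Z₂) S₂) :
    ∃ U ∈ 𝓝ˢ C, ∃ g : Z → P, ContinuousOn g U ∧ MapsTo g U (S₁ ∪ S₂) ∧ EqOn g f C := by
  have hZ₀ : IsClosed (Z₁ ∩ Z₂) := hZ₁.inter hZ₂
  obtain ⟨K, hK, hKc, g, hg, hgS, hgf⟩ := hS.exists_extension_union_inter hC hZ₀ hf
    fun z hz => ⟨hf₁ ⟨hz.1, hz.2.1⟩, hf₂ ⟨hz.1, hz.2.2⟩⟩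
  set D : Set Z := C ∪ K ∩ (Z₁ ∩ Z₂)
  have hD : IsClosed D := hC.union (hKc.inter hZ₀)
  have hg₁ : MapsTo g (D ∩ Z₁) S₁ := by
    rintro z ⟨hz | hz, hz₁⟩
    · exact hgf hz ▸ hf₁ ⟨hz, hz₁⟩
    · exact (hgS hz).1
  have hg₂ : MapsTo g (D ∩ Z₂) S₂ := by
    rintro z ⟨hz | hz, hz₂⟩
    · exact hgf hz ▸ hf₂ ⟨hz, hz₂⟩
    · exact (hgS hz).2
  obtain ⟨K₁, hK₁, hKc₁, g₁, hgc₁, hgS₁, hgg₁⟩ :=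
    hS₁.exists_isClosed (hD.inter hZ₁) (hg.mono inter_subset_left) hg₁
  obtain ⟨K₂, hK₂, hKc₂, g₂, hgc₂, hgS₂, hgg₂⟩ :=
    hS₂.exists_isClosed (hD.inter hZ₂) (hg.mono inter_subset_left) hg₂
  obtain ⟨N, hN, hNc, hNK⟩ :=
    exists_mem_nhdsSet_isClosed_subset (union_compl_mem_nhdsSet hZ₀ hK) hC
  have hCD : C ⊆ D := subset_union_left
  have hglue : EqOn g₁ g₂ ((K₁ ∩ N ∩ Z₁) ∩ (K₂ ∩ Z₂)) := by
    rintro z ⟨⟨⟨-, hzN⟩, hz₁⟩, -, hz₂⟩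
    have hzD : z ∈ D := Or.inr ⟨(hNK hzN).resolve_right fun h => h ⟨hz₁, hz₂⟩, hz₁, hz₂⟩
    rw [hgg₁ ⟨hzD, hz₁⟩, hgg₂ ⟨hzD, hz₂⟩]
  exact exists_extension_of_eqOn_inter hZ₁ hZ₂ hZ (hKc₁.inter hNc) hKc₂
    (Filter.inter_mem (nhdsSet_mono (inter_subset_inter_left _ hCD) hK₁)
      (nhdsSet_mono inter_subset_left hN))
    (nhdsSet_mono (inter_subset_inter_left _ hCD) hK₂) (hgc₁.mono inter_subset_left) hgc₂
    (fun z hz => Or.inl (hgS₁ hz.1)) (fun z hz => Or.inr (hgS₂ hz)) hglue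
    (fun z hz => (hgg₁ ⟨hCD hz.1, hz.2⟩).trans (hgf hz.1))
    fun z hz => (hgg₂ ⟨hCD hz.1, hz.2⟩).trans (hgf hz.1)

theorem IsNbhdExtensor.union_of_isClosed [CompletelyNormalSpace Z] {S₁ S₂ : Set P}
    (hS₁ : IsNbhdExtensor Z S₁) (hS₂ : IsNbhdExtensor Z S₂) (hS : IsNbhdExtensor Z (S₁ ∩ S₂))
    (hSc₁ : IsClosed S₁) (hSc₂ : IsClosed S₂) : IsNbhdExtensor Z (S₁ ∪ S₂) := by
  intro C f hC hf hfS
  have hC' : C ∩ f ⁻¹' S₁ ∪ C ∩ f ⁻¹' S₂ = C := by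
    rw [← inter_union_distrib_left, ← preimage_union]
    exact inter_eq_left.2 hfS
  obtain ⟨Z₁, Z₂, hZ₁, hZ₂, hZ, hCZ₁, hCZ₂⟩ := exists_isClosed_cover_inter_subset
    (hf.preimage_isClosed_of_isClosed hC hSc₁) (hf.preimage_isClosed_of_isClosed hC hSc₂)
  rw [hC'] at hCZ₁ hCZ₂
  exact exists_extension_of_isClosed_cover hS₁ hS₂ hS hC hZ₁ hZ₂ hZ hf
    (fun z hz => (hCZ₁ hz).2) fun z hz => (hCZ₂ hz).2

end Union

/-! ### Being a neighbourhood extensor is a local property -/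

section Local

variable {Z P : Type*} [TopologicalSpace Z] [TopologicalSpace P]

theorem exists_eqOn_of_monotone {α β : Type*} {B : ℕ → Set α} {g : ℕ → α → β} (hB : Monotone B)
    (hg : ∀ i, EqOn (g (i + 1)) (g i) (B i)) : ∃ l : α → β, ∀ i, EqOn l (g i) (B i) := by
  classical
  have hgg : ∀ i j, i ≤ j → EqOn (g j) (g i) (B i) := fun i j hij => by
    induction j, hij using Nat.le_induction with
    | base => exact eqOn_refl _ _
    | succ j hij ih => exact fun z hz => (hg j (hB hij hz)).trans (ih hz)
  refine ⟨fun z => if h : ∃ i, z ∈ B i then g (Nat.find h) z else g 0 z, fun i z hz => ?_⟩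
  have h : ∃ i, z ∈ B i := ⟨i, hz⟩
  simp only [dif_pos h]
  exact (hgg _ _ (Nat.find_min' h hz) (Nat.find_spec h)).symm

theorem IsNbhdExtensor.exists_extension_of_mapsTo_isOpen [NormalSpace Z] {S O : Set P}
    (hSO : IsNbhdExtensor Z (S ∩ O)) (hO : IsOpen O) {B C : Set Z} (hB : IsClosed B)
    (hC : IsClosed C) (hCB : C ⊆ B) {g : Z → P} (hg : ContinuousOn g B) (hgS : MapsTo g B S)
    (hgO : MapsTo g C O) :
    ∃ B', IsClosed B' ∧ B ⊆ B' ∧ B' ∈ 𝓝ˢ C ∧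
      ∃ g', ContinuousOn g' B' ∧ MapsTo g' B' S ∧ EqOn g' g B := by
  have hA : IsClosed (B ∩ g ⁻¹' Oᶜ) := hg.preimage_isClosed_of_isClosed hB hO.isClosed_compl
  have hCA : (B ∩ g ⁻¹' Oᶜ)ᶜ ∈ 𝓝ˢ C :=
    hA.isOpen_compl.mem_nhdsSet.2 fun z hz h => h.2 (hgO hz)
  obtain ⟨N, hN, hNc, hNA⟩ := exists_mem_nhdsSet_isClosed_subset hCA hC
  have hgSO : MapsTo g (B ∩ N) (S ∩ O) := fun z hz =>
    ⟨hgS hz.1, not_not.1 fun h => hNA hz.2 ⟨hz.1, h⟩⟩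
  obtain ⟨K, hK, hKc, l, hl, hlS, hlg⟩ :=
    hSO.exists_isClosed (hB.inter hNc) (hg.mono inter_subset_left) hgSO
  obtain ⟨g', hg', hgS', hgg', -⟩ := exists_continuousOn_union hB (hNc.inter hKc) hg
    (hl.mono inter_subset_right) hgS (fun z hz => (hlS hz.2).1)
    fun z hz => (hlg ⟨hz.1, hz.2.1⟩).symm
  have hCN : C ⊆ B ∩ N := subset_inter hCB (subset_of_mem_nhdsSet hN)
  exact ⟨B ∪ N ∩ K, hB.union (hNc.inter hKc), subset_union_left,
    Filter.mem_of_superset (Filter.inter_mem hN (nhdsSet_mono hCN hK)) subset_union_right,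
    g', hg', hgS', hgg'⟩

/-- The map `g` extends `f : C → S` to the closed subset `B`. -/
structure IsClosedExtension (f : Z → P) (C : Set Z) (S : Set P) (B : Set Z) (g : Z → P) :
    Prop where
  isClosed : IsClosed B
  subset : C ⊆ B
  continuousOn : ContinuousOn g B
  mapsTo : MapsTo g B S
  eqOn : EqOn g f C

theorem exists_seq_isClosedExtension [NormalSpace Z] {S : Set P} {K O : ℕ → Set P}
    (hK : ∀ i, IsClosed (K i)) (hO : ∀ i, IsOpen (O i)) (hKO : ∀ i, K i ⊆ O i)
    (hSO : ∀ i, IsNbhdExtensor Z (S ∩ O i)) {C : Set Z} {f : Z → P} (hC : IsClosed C)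
    (hf : ContinuousOn f C) (hfS : MapsTo f C S) :
    ∃ (B : ℕ → Set Z) (g : ℕ → Z → P), (∀ i, IsClosedExtension f C S (B i) (g i)) ∧
      ∀ i, B i ⊆ B (i + 1) ∧ B (i + 1) ∈ 𝓝ˢ (C ∩ f ⁻¹' K i) ∧ EqOn (g (i + 1)) (g i) (B i) := by
  have hstep : ∀ (i : ℕ) (s : {s : Set Z × (Z → P) // IsClosedExtension f C S s.1 s.2}),
      ∃ t : {s : Set Z × (Z → P) // IsClosedExtension f C S s.1 s.2},
        s.1.1 ⊆ t.1.1 ∧ t.1.1 ∈ 𝓝ˢ (C ∩ f ⁻¹' K i) ∧ EqOn t.1.2 s.1.2 s.1.1 := by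
    rintro i ⟨⟨B, g⟩, hg⟩
    obtain ⟨B', hB', hBB', hCB', g', hg', hgS', hgg'⟩ :=
      (hSO i).exists_extension_of_mapsTo_isOpen (hO i) hg.isClosed
        (hf.preimage_isClosed_of_isClosed hC (hK i)) (inter_subset_left.trans hg.subset)
        hg.continuousOn hg.mapsTo fun z hz => hKO i (by rw [hg.eqOn hz.1]; exact hz.2)
    exact ⟨⟨(B', g'), hB', hg.subset.trans hBB', hg', hgS',
      (hgg'.mono hg.subset).trans hg.eqOn⟩, hBB', hCB', hgg'⟩
  choose next hnext using hstep
  let s (i : ℕ) : {s : Set Z × (Z → P) // IsClosedExtension f C S s.1 s.2} :=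
    Nat.rec ⟨(C, f), hC, Subset.rfl, hf, hfS, eqOn_refl f C⟩ next i
  exact ⟨fun i => (s i).1.1, fun i => (s i).1.2, fun i => (s i).2, fun i => hnext i (s i)⟩

theorem isNbhdExtensor_of_countable_cover [NormalSpace Z] {S : Set P} {K O : ℕ → Set P}
    (hK : ∀ i, IsClosed (K i)) (hO : ∀ i, IsOpen (O i)) (hKO : ∀ i, K i ⊆ O i)
    (hS : S ⊆ ⋃ i, K i) (hSO : ∀ i, IsNbhdExtensor Z (S ∩ O i)) : IsNbhdExtensor Z S := by
  intro C f hC hf hfS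
  obtain ⟨B, g, hg, hBg⟩ := exists_seq_isClosedExtension hK hO hKO hSO hC hf hfS
  obtain ⟨l, hl⟩ := exists_eqOn_of_monotone (monotone_nat_of_le_succ fun i => (hBg i).1)
    fun i => (hBg i).2.2
  refine ⟨⋃ i, interior (B i), (isOpen_iUnion fun i => isOpen_interior).mem_nhdsSet.2 ?_, l,
    fun z hz => ?_, fun z hz => ?_, (hl 0).mono (hg 0).subset |>.trans (hg 0).eqOn⟩
  · intro z hz
    obtain ⟨i, hi⟩ := mem_iUnion.1 (hS (hfS hz))
    exact mem_iUnion.2 ⟨i + 1, subset_interior_iff_mem_nhdsSet.2 (hBg i).2.1 ⟨hz, hi⟩⟩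
  · obtain ⟨i, hi⟩ := mem_iUnion.1 hz
    exact (((hg i).continuousOn.congr (hl i)).continuousAt
      (mem_interior_iff_mem_nhds.1 hi)).continuousWithinAt
  · obtain ⟨i, hi⟩ := mem_iUnion.1 hz
    exact hl i (interior_subset hi) ▸ (hg i).mapsTo (interior_subset hi)

theorem isNbhdExtensor_of_local [NormalSpace Z] [RegularSpace P] [SecondCountableTopology P]
    {S : Set P} (hS : ∀ x ∈ S, ∃ O, IsOpen O ∧ x ∈ O ∧ IsNbhdExtensor Z (S ∩ O)) :
    IsNbhdExtensor Z S := by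
  choose! O hO hxO hSO using hS
  have hK : ∀ x ∈ S, ∃ K ∈ 𝓝 x, IsClosed K ∧ K ⊆ O x := fun x hx =>
    exists_mem_nhds_isClosed_subset ((hO x hx).mem_nhds (hxO x hx))
  choose! K hK hKc hKO using hK
  obtain ⟨t, htS, htc, ht⟩ := TopologicalSpace.countable_cover_nhdsWithin
    fun x hx => mem_nhdsWithin_of_mem_nhds (hK x hx)
  rcases t.eq_empty_or_nonempty with rfl | hne
  · obtain rfl : S = ∅ := by simpa using ht
    exact isNbhdExtensor_empty
  · obtain ⟨e, rfl⟩ := htc.exists_eq_range hne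
    have he : ∀ i, e i ∈ S := fun i => htS (mem_range_self i)
    exact isNbhdExtensor_of_countable_cover (fun i => hKc _ (he i)) (fun i => hO _ (he i))
      (fun i => hKO _ (he i)) (by simpa using ht) fun i => hSO _ (he i)

end Local

/-! ### Manifolds with cylinders are neighbourhood extensors -/

section Neat

theorem exists_mem_direction_forall_nonneg {E : Type*} [AddCommGroup E] [Module ℝ E]
    (ℓ : E →ₗ[ℝ] ℝ) (L : Submodule ℝ E) {e : E} (he : 0 ≤ ℓ e) :
    ∃ w ∈ L, ∀ y, y - e ∈ L → 0 ≤ ℓ (y + max 0 (-ℓ y) • w) := by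
  by_cases hL : ∃ v ∈ L, ℓ v ≠ 0
  · obtain ⟨v, hv, hℓv⟩ := hL
    refine ⟨(ℓ v)⁻¹ • v, L.smul_mem _ hv, fun y _ => ?_⟩
    have : -ℓ y ≤ max 0 (-ℓ y) := le_max_right _ _
    simp only [map_add, map_smul, smul_eq_mul, inv_mul_cancel₀ hℓv]
    linarith
  · push Not at hL
    refine ⟨0, L.zero_mem, fun y hy => ?_⟩
    have : ℓ y - ℓ e = 0 := by rw [← map_sub, hL _ hy]
    rw [smul_zero, add_zero]
    linarith

theorem exists_retraction_affine_halfSpace {E : Type*} [AddCommGroup E] [Module ℝ E]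
    [TopologicalSpace E] [IsTopologicalAddGroup E] [ContinuousSMul ℝ E] (ℓ : E →L[ℝ] ℝ)
    {L : Submodule ℝ E} (hL : L.ClosedComplemented) {e : E} (he : 0 ≤ ℓ e) :
    ∃ ρ : E → E, Continuous ρ ∧ (∀ y, 0 ≤ ℓ (ρ y) ∧ ρ y - e ∈ L) ∧
      ∀ y, 0 ≤ ℓ y → y - e ∈ L → ρ y = y := by
  obtain ⟨π, hπ⟩ := hL
  obtain ⟨w, hw, hℓw⟩ := exists_mem_direction_forall_nonneg (ℓ : E →ₗ[ℝ] ℝ) L he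
  let p (y : E) : E := e + π (y - e)
  have hpL : ∀ y, p y - e ∈ L := fun y => by
    rw [add_sub_cancel_left]
    exact (π (y - e)).2
  have hpe : ∀ y, y - e ∈ L → p y = y := fun y hy =>
    (congrArg (fun v : L => e + (v : E)) (hπ ⟨y - e, hy⟩)).trans (add_sub_cancel e y)
  refine ⟨fun y => p y + max 0 (-ℓ (p y)) • w, by fun_prop, fun y => ⟨hℓw _ (hpL y), ?_⟩,
    fun y hy hyL => ?_⟩
  · rw [add_sub_right_comm]
    exact L.add_mem (hpL y) (L.smul_mem _ hw)
  · simp [hpe y hyL, hy]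

variable {E : Type*} [NormedAddCommGroup E] [NormedSpace ℝ E]

theorem IsBoundaryModel.exists_range_eq {H : Type*} [TopologicalSpace H]
    {I : ModelWithCorners ℝ E H} (hI : IsBoundaryModel I) :
    ∃ ℓ : E →L[ℝ] ℝ, range I = {y | 0 ≤ ℓ y} := by
  rcases hI with hI | ⟨ℓ, -, hℓ⟩
  · exact ⟨0, by simp [hI]⟩
  · exact ⟨ℓ, hℓ⟩

variable [FiniteDimensional ℝ E]

theorem isNbhdExtensor_affine_halfSpace {Z : Type*} [TopologicalSpace Z] [NormalSpace Z]
    (ℓ : E →L[ℝ] ℝ) (L : Submodule ℝ E) {e : E} (he : 0 ≤ ℓ e) :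
    IsNbhdExtensor Z {y | 0 ≤ ℓ y ∧ y - e ∈ L} := by
  have : TietzeExtension E := TietzeExtension.of_tvs ℝ
  obtain ⟨ρ, hρ, hρL, hρe⟩ := exists_retraction_affine_halfSpace ℓ
    (Submodule.ClosedComplemented.of_finiteDimensional L) he
  exact (isNbhdExtensor_univ (P := E)).retract continuousOn_id (mapsTo_univ _ _) hρ.continuousOn
    (fun y _ => hρL y) fun y hy => hρe y hy.1 hy.2

variable {H : Type*} [TopologicalSpace H] {I : ModelWithCorners ℝ E H} {M : Type*}
  [TopologicalSpace M]

theorem isNbhdExtensor_inter_source {Z : Type*} [TopologicalSpace Z] [NormalSpace Z]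
    (hI : IsBoundaryModel I) (φ : OpenPartialHomeomorph M H) {N : Set M} {e : E}
    (he : e ∈ range I) (L : Submodule ℝ E)
    (hL : ∀ y ∈ φ.source, y ∈ N ↔ φ.extend I y - e ∈ L) :
    IsNbhdExtensor Z (N ∩ φ.source) := by
  obtain ⟨ℓ, hℓ⟩ := hI.exists_range_eq
  rw [hℓ] at he
  have hT := (isNbhdExtensor_affine_halfSpace (Z := Z) ℓ L he).inter_isOpen
    (φ.open_target.preimage I.continuous_symm)
  have hmem : ∀ y, y ∈ (φ.extend I).target ↔ y ∈ I.symm ⁻¹' φ.target ∧ 0 ≤ ℓ y := fun y => by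
    rw [φ.extend_target, hℓ]
    rfl
  refine hT.retract (i := φ.extend I) (r := (φ.extend I).symm) (φ.continuousOn_extend.mono ?_)
    (fun x hx => ?_) (φ.continuousOn_extend_symm.mono ?_) (fun y hy => ?_) fun x hx => ?_
  · rw [φ.extend_source]
    exact inter_subset_right
  · have hx' := (hmem _).1 ((φ.extend I).map_source (φ.extend_source (I := I) ▸ hx.2))
    exact ⟨⟨hx'.2, (hL x hx.2).1 hx.1⟩, hx'.1⟩
  · exact fun y hy => (hmem y).2 ⟨hy.2, hy.1.1⟩
  · have hy' := (hmem y).2 ⟨hy.2, hy.1.1⟩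
    have hys := φ.extend_source (I := I) ▸ (φ.extend I).map_target hy'
    refine ⟨(hL _ hys).2 ?_, hys⟩
    rw [(φ.extend I).right_inv hy']
    exact hy.1.2
  · exact φ.extend_left_inv hx.2

theorem IsNeatSubmanifold.isNbhdExtensor {Z : Type*} [TopologicalSpace Z] [NormalSpace Z]
    [ChartedSpace H M] [RegularSpace M] [SecondCountableTopology M] (hI : IsBoundaryModel I)
    {N : Set M} (hN : IsNeatSubmanifold I N) : IsNbhdExtensor Z N := by
  refine isNbhdExtensor_of_local fun x hx => ?_
  obtain ⟨φ, -, hxφ, L, hL, -⟩ := hN.2 x hx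
  exact ⟨φ.source, φ.open_source, hxφ, isNbhdExtensor_inter_source hI φ (mem_range_self _) L hL⟩

end Neat

/-! ### The homotopy extension property for continuous maps -/

section HEP

variable {B : Type*} [TopologicalSpace B] {X A D : Set B}

theorem isNbhdExtensor_prod_union_prod {Z : Type*} [TopologicalSpace Z] [CompletelyNormalSpace Z]
    (hX : IsNbhdExtensor Z X) (hA : IsNbhdExtensor Z A) (hXc : IsClosed X) (hAc : IsClosed A)
    (hAX : A ⊆ X) : IsNbhdExtensor Z (X ×ˢ {(0 : ℝ)} ∪ A ×ˢ Icc (0 : ℝ) 1) := by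
  refine (hX.prod (isNbhdExtensor_singleton 0)).union_of_isClosed
    (hA.prod (isNbhdExtensor_Icc zero_le_one)) ?_ (hXc.prod isClosed_singleton)
    (hAc.prod isClosed_Icc)
  rw [prod_inter_prod, inter_eq_right.2 hAX,
    inter_eq_left.2 (singleton_subset_iff.2 (left_mem_Icc.2 zero_le_one))]
  exact hA.prod (isNbhdExtensor_singleton 0)

theorem isNbhdExtensor_prod_union_prod_union_prod {Z : Type*} [TopologicalSpace Z]
    [CompletelyNormalSpace Z] (hX : IsNbhdExtensor Z X) (hA : IsNbhdExtensor Z A)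
    (hD : IsNbhdExtensor Z D) (hXc : IsClosed X) (hAc : IsClosed A) (hDc : IsClosed D)
    (hAX : A ⊆ X) (hAD : A ⊆ D) :
    IsNbhdExtensor Z (X ×ˢ {(0 : ℝ)} ∪ A ×ˢ Icc (0 : ℝ) 1 ∪ D ×ˢ {(1 : ℝ)}) := by
  refine (isNbhdExtensor_prod_union_prod hX hA hXc hAc hAX).union_of_isClosed
    (hD.prod (isNbhdExtensor_singleton 1)) ?_
    ((hXc.prod isClosed_singleton).union (hAc.prod isClosed_Icc)) (hDc.prod isClosed_singleton)
  rw [union_inter_distrib_right, prod_inter_prod, prod_inter_prod, inter_eq_left.2 hAD,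
    inter_eq_right.2 (singleton_subset_iff.2 (right_mem_Icc.2 zero_le_one)),
    singleton_inter_eq_empty.2 (by simp), prod_empty, empty_union]
  exact hA.prod (isNbhdExtensor_singleton 1)

theorem exists_continuous_forall_mul_mem [NormalSpace B] (hA : IsClosed A) {U : Set (B × ℝ)}
    (hU : IsOpen U) (hAU : A ×ˢ Icc (0 : ℝ) 1 ⊆ U) :
    ∃ u : C(B, ℝ), EqOn u 1 A ∧
      ∀ b, u b = 0 ∨ ∀ t ∈ Icc (0 : ℝ) 1, (b, t * u b) ∈ U := by
  have hW : IsOpen {b | ∀ t ∈ Icc (0 : ℝ) 1, (b, t) ∈ U} := isOpen_iff_mem_nhds.2 fun b hb =>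
    isCompact_Icc.eventually_forall_of_forall_eventually fun t ht => hU.mem_nhds (hb t ht)
  obtain ⟨u, hu₀, hu₁, hu⟩ := exists_continuous_zero_one_of_isClosed hW.isClosed_compl hA
    (disjoint_compl_left_iff_subset.2 fun b hb t ht => hAU (mk_mem_prod hb ht))
  refine ⟨u, hu₁, fun b => ?_⟩
  by_cases hb : ∀ t ∈ Icc (0 : ℝ) 1, (b, t) ∈ U
  · exact Or.inr fun t ht =>
      hb _ ⟨mul_nonneg ht.1 (hu b).1, mul_le_one₀ ht.2 (hu b).1 (hu b).2⟩
  · exact Or.inl (hu₀ hb)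

theorem exists_retraction_of_isNbhdExtensor [NormalSpace B] (hX : IsClosed X) (hA : IsClosed A)
    (h : IsNbhdExtensor (B × ℝ) (X ×ˢ {(0 : ℝ)} ∪ A ×ˢ Icc (0 : ℝ) 1)) :
    ∃ r : B × ℝ → B × ℝ, ContinuousOn r (X ×ˢ Icc (0 : ℝ) 1) ∧
      MapsTo r (X ×ˢ Icc (0 : ℝ) 1) (X ×ˢ {(0 : ℝ)} ∪ A ×ˢ Icc (0 : ℝ) 1) ∧
      EqOn r id (X ×ˢ {(0 : ℝ)} ∪ A ×ˢ Icc (0 : ℝ) 1) := by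
  obtain ⟨U₀, hU₀, r, hr, hrT, hre⟩ := h _ id
    ((hX.prod isClosed_singleton).union (hA.prod isClosed_Icc)) continuousOn_id (mapsTo_id _)
  obtain ⟨U, hU, hTU, hUU₀⟩ := mem_nhdsSet_iff_exists.1 hU₀
  obtain ⟨u, huA, hu⟩ := exists_continuous_forall_mul_mem hA hU (subset_union_right.trans hTU)
  have hmem : MapsTo (fun x : B × ℝ => (x.1, x.2 * u x.1)) (X ×ˢ Icc (0 : ℝ) 1) U₀ :=
    fun x hx => hUU₀ <| by
      rcases hu x.1 with h0 | h1
      · exact hTU (Or.inl ⟨hx.1, by simp [h0]⟩)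
      · exact h1 _ hx.2
  refine ⟨fun x => r (x.1, x.2 * u x.1), hr.comp (by fun_prop) hmem, hrT.comp hmem, fun x hx => ?_⟩
  have hxu : (x.1, x.2 * u x.1) = x := by
    rcases hx with ⟨-, h0⟩ | ⟨hA, -⟩
    · rw [mem_singleton_iff] at h0
      exact Prod.ext rfl (by simp [h0])
    · exact Prod.ext rfl (by simp [huA hA])
  exact (congrArg r hxu).trans (hre hx)

end HEP

section Cylinders

variable {M : Type*} [TopologicalSpace M] {k : ℕ} {X A D : Set (M × (Fin k → ℝ))}

variable (M k) in
/-- `M × ℝᵏ⁺¹` as the product of `M × ℝᵏ` with the last coordinate. -/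
def splitLast : M × (Fin (k + 1) → ℝ) ≃ₜ (M × (Fin k → ℝ)) × ℝ where
  toFun x := ((x.1, Fin.init x.2), x.2 (Fin.last k))
  invFun y := (y.1.1, Fin.snoc y.1.2 y.2)
  left_inv x := by simp
  right_inv y := by simp
  continuous_toFun := (continuous_fst.prodMk continuous_snd.finInit).prodMk (by fun_prop)
  continuous_invFun := continuous_fst.fst.prodMk
    (Continuous.finSnoc (A := fun _ => ℝ) continuous_fst.snd continuous_snd)

theorem cyl_eq_preimage (X A : Set (M × (Fin k → ℝ))) :
    cyl X A = splitLast M k ⁻¹' (X ×ˢ {0} ∪ A ×ˢ Icc 0 1) := rfl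

theorem cyl_union_top_eq_preimage (X A D : Set (M × (Fin k → ℝ))) :
    cyl X A ∪ top D = splitLast M k ⁻¹' (X ×ˢ {0} ∪ A ×ˢ Icc 0 1 ∪ D ×ˢ {1}) := rfl

theorem isClosed_cyl (hX : IsClosed X) (hA : IsClosed A) : IsClosed (cyl X A) := by
  rw [cyl_eq_preimage]
  exact ((hX.prod isClosed_singleton).union (hA.prod isClosed_Icc)).preimage
    (splitLast M k).continuous

theorem isClosed_top (hD : IsClosed D) : IsClosed (top D) :=
  (hD.prod isClosed_singleton).preimage (splitLast M k).continuous

variable {E : Type*} [NormedAddCommGroup E] [NormedSpace ℝ E] {H : Type*} [TopologicalSpace H]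
  {I : ModelWithCorners ℝ E H} [ChartedSpace H M]

theorem IsManifoldWithCylinders.isClosed {k : ℕ} {X : Set (M × (Fin k → ℝ))}
    (hX : IsManifoldWithCylinders I k X) : IsClosed X := by
  induction hX with
  | base N hN => exact hN.1.preimage continuous_fst
  | cyl k X A _ _ _ hX hA => exact isClosed_cyl hX hA
  | cylTop k X A D _ _ _ _ _ hX hA hD => exact (isClosed_cyl hX hA).union (isClosed_top hD)

variable [FiniteDimensional ℝ E] [SecondCountableTopology M]

theorem IsManifoldWithCylinders.isNbhdExtensor {Z : Type*} [TopologicalSpace Z]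
    [CompletelyNormalSpace Z] [RegularSpace M] (hI : IsBoundaryModel I) {k : ℕ}
    {X : Set (M × (Fin k → ℝ))} (hX : IsManifoldWithCylinders I k X) : IsNbhdExtensor Z X := by
  induction hX with
  | base N hN =>
    exact (hN.isNbhdExtensor hI).retract (i := Prod.fst) (r := fun x => (x, default))
      continuousOn_fst (fun _ hx => hx) (by fun_prop) (fun _ hx => hx)
      fun x _ => Prod.ext rfl (Subsingleton.elim _ _)
  | cyl k X A hX hA hAX ihX ihA =>
    rw [cyl_eq_preimage]
    exact (isNbhdExtensor_prod_union_prod ihX ihA hX.isClosed hA.isClosed hAX).preimage_homeomorph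
      (splitLast M k)
  | cylTop k X A D hX hA hD hAX hAD ihX ihA ihD =>
    rw [cyl_union_top_eq_preimage]
    exact (isNbhdExtensor_prod_union_prod_union_prod ihX ihA ihD hX.isClosed hA.isClosed
      hD.isClosed hAX hAD).preimage_homeomorph (splitLast M k)

theorem exists_continuousMap_extension [T2Space M] (hI : IsBoundaryModel I) {Y : Type*}
    [TopologicalSpace Y] (hX : IsManifoldWithCylinders I k X) (hA : IsManifoldWithCylinders I k A)
    (hAX : A ⊆ X) (f : C(cyl X A, Y)) :
    ∃ F : C(prodI X, Y), ∀ x, F (inclusion (cyl_subset_prodI hAX) x) = f x := by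
  have := I.locallyCompactSpace
  have := ChartedSpace.locallyCompactSpace H M
  let := TopologicalSpace.metrizableSpaceMetric M
  obtain ⟨r, hr, hrT, hre⟩ := exists_retraction_of_isNbhdExtensor hX.isClosed hA.isClosed
    (isNbhdExtensor_prod_union_prod (hX.isNbhdExtensor hI) (hA.isNbhdExtensor hI)
      hX.isClosed hA.isClosed hAX)
  let e := splitLast M k
  have hmem : ∀ x : prodI X, e.symm (r (e x)) ∈ cyl X A := fun x => by
    rw [cyl_eq_preimage, mem_preimage, e.apply_symm_apply]
    exact hrT x.2
  have hcont : Continuous fun x : prodI X => e.symm (r (e x)) :=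
    e.symm.continuous.comp
      (hr.comp_continuous (e.continuous.comp continuous_subtype_val) fun x => x.2)
  refine ⟨f.comp ⟨fun x => ⟨_, hmem x⟩, hcont.subtype_mk hmem⟩, fun x => congrArg f ?_⟩
  exact Subtype.ext ((congrArg e.symm (hre x.2)).trans (e.symm_apply_apply x.1))

end Cylinders

/-! ### Cochains of graded sets with faces -/

section AlternatingSums

variable {W : Type*} [AddCommGroup W]

theorem sum_sum_neg_one_pow_eq_zero {n : ℕ} (a : Fin (n + 2) → Fin (n + 1) → W)
    (ha : ∀ i j, a i j = a (i.succAbove j) (j.predAbove i)) :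
    ∑ i : Fin (n + 2), ∑ j : Fin (n + 1), (-1 : ℤ) ^ (i + j : ℕ) • a i j = 0 := by
  rw [← Finset.sum_product']
  refine Finset.sum_involution (fun x _ => (x.1.succAbove x.2, x.2.predAbove x.1))
    (fun x _ => ?_) (fun x _ _ hx => Fin.succAbove_ne x.1 x.2 (congrArg Prod.fst hx))
    (fun _ _ => Finset.mem_univ _) fun x _ =>
      Prod.ext (Fin.succAbove_succAbove_predAbove _ _) (Fin.predAbove_predAbove_succAbove _ _)
  rw [← ha, Fin.neg_one_pow_succAbove_add_predAbove, neg_smul, add_neg_cancel]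

theorem neg_one_pow_succAbove_add_succAbove {n : ℕ} (y : Fin (n + 1)) (i : Fin n) :
    (-1 : ℤ) ^ (y.succAbove i + (y.succAbove i).castSucc.succAbove y : ℕ) =
      -(-1) ^ (i + y : ℕ) := by
  rw [← neg_one_mul (_ ^ _), ← pow_succ', neg_one_pow_congr]
  rcases lt_or_ge i.castSucc y with h | h
  · rw [Fin.succAbove_of_castSucc_lt _ _ h,
      Fin.succAbove_of_le_castSucc _ _ (Fin.castSucc_le_castSucc_iff.2 h.le)]
    simp [add_assoc]
  · rw [Fin.succAbove_of_le_castSucc _ _ h, Fin.succAbove_of_castSucc_lt _ _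
      (Fin.castSucc_lt_castSucc_iff.2 (h.trans_lt Fin.castSucc_lt_succ))]
    simp [add_right_comm]

/-- A term `a i y` stands for the `y`-th face of the `i`-th simplex of a prism. The faces
`i.castSucc` and `i.succ` are interior; the others are indexed by a face `y` of the base and a
simplex `i` of the prism over that face. -/
theorem sum_sum_neg_one_pow_prism {n : ℕ} (a : Fin (n + 1) → Fin (n + 2) → W) :
    ∑ i : Fin (n + 1), ∑ y : Fin (n + 2), (-1 : ℤ) ^ (i + y : ℕ) • a i y =
      ∑ i, (a i i.castSucc - a i i.succ) - ∑ y : Fin (n + 1), ∑ i : Fin n,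
        (-1 : ℤ) ^ (i + y : ℕ) • a (y.succAbove i) ((y.succAbove i).castSucc.succAbove y) := by
  have hrow (i : Fin (n + 1)) : ∑ y : Fin (n + 2), (-1 : ℤ) ^ (i + y : ℕ) • a i y =
      a i i.castSucc + ∑ y : Fin (n + 1), (-1 : ℤ) ^ (i + i.castSucc.succAbove y : ℕ) •
        a i (i.castSucc.succAbove y) := by
    rw [Fin.sum_univ_succAbove _ i.castSucc, Fin.val_castSucc, (Even.add_self _).neg_one_pow,
      one_smul]
  have hcolumn (y : Fin (n + 1)) : ∑ i : Fin (n + 1),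
      (-1 : ℤ) ^ (i + i.castSucc.succAbove y : ℕ) • a i (i.castSucc.succAbove y) =
      -a y y.succ - ∑ i : Fin n, (-1 : ℤ) ^ (i + y : ℕ) •
        a (y.succAbove i) ((y.succAbove i).castSucc.succAbove y) := by
    rw [Fin.sum_univ_succAbove _ y, Fin.succAbove_castSucc_self, Fin.val_succ, ← add_assoc,
      (Even.add_self _).add_one.neg_one_pow, neg_one_smul, sub_eq_add_neg, ← Finset.sum_neg_distrib]
    simp only [neg_one_pow_succAbove_add_succAbove, neg_smul]
  rw [Finset.sum_congr rfl fun i _ => hrow i, Finset.sum_add_distrib, Finset.sum_comm,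
    Finset.sum_congr rfl fun y _ => hcolumn y]
  simp only [Finset.sum_sub_distrib, Finset.sum_neg_distrib]
  abel

theorem sum_castSucc_sub_succ {n : ℕ} (b : Fin (n + 1) → W) :
    ∑ i : Fin n, (b i.castSucc - b i.succ) = b 0 - b (Fin.last n) := by
  rw [Finset.sum_sub_distrib, ← add_sub_add_right_eq_sub _ _ (b (Fin.last n)),
    ← Fin.sum_univ_castSucc, Fin.sum_univ_succ]
  abel

end AlternatingSums

section Cochains

variable {Simp Simp' : ℕ → Type*} {V : ℤ → Type*} {n : ℤ}

/-- The pull-back of a cochain along a map of graded sets. -/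
def Cochain.comap (φ : ∀ p, Simp' p → Simp p) (c : Cochain Simp V n) : Cochain Simp' V n :=
  fun p q hpq σ => c p q hpq (φ p σ)

/-- A cochain of degree `m`, regarded as one of the equal degree `n`. -/
def Cochain.cast {m : ℤ} (hmn : m = n) (c : Cochain Simp V m) : Cochain Simp V n :=
  fun p q hpq => c p q (hpq.trans hmn.symm)

@[ext]
theorem Cochain.ext {c d : Cochain Simp V n} (h : ∀ p q hpq σ, c p q hpq σ = d p q hpq σ) :
    c = d :=
  funext fun p => funext fun q => funext fun hpq => funext fun σ => h p q hpq σ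

variable [∀ q, AddCommGroup (V q)] {face : ∀ p : ℕ, Fin (p + 2) → Simp (p + 1) → Simp p}
  {face' : ∀ p : ℕ, Fin (p + 2) → Simp' (p + 1) → Simp' p}

instance : AddCommGroup (Cochain Simp V n) :=
  Equiv.addCommGroup (β := ∀ x : {x : ℕ × ℤ // (x.1 : ℤ) + x.2 = n}, Simp x.1.1 → V x.1.2)
    { toFun c x := c x.1.1 x.1.2 x.2
      invFun c p q hpq := c ⟨(p, q), hpq⟩
      left_inv _ := rfl
      right_inv _ := rfl }

theorem Cochain.add_apply (c d : Cochain Simp V n) (p : ℕ) (q : ℤ) (hpq : (p : ℤ) + q = n)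
    (σ : Simp p) : (c + d) p q hpq σ = c p q hpq σ + d p q hpq σ := rfl

theorem Cochain.comap_add (φ : ∀ p, Simp' p → Simp p) (c d : Cochain Simp V n) :
    (c + d).comap φ = c.comap φ + d.comap φ := rfl

theorem Cochain.comap_sub (φ : ∀ p, Simp' p → Simp p) (c d : Cochain Simp V n) :
    (c - d).comap φ = c.comap φ - d.comap φ := rfl

theorem Cochain.apply_eq_zero_of_mem_range {φ : ∀ p, Simp' p → Simp p} {c : Cochain Simp V n}
    (hc : c.comap φ = 0) {p : ℕ} {q : ℤ} (hpq : (p : ℤ) + q = n) {σ : Simp p}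
    (hσ : σ ∈ range (φ p)) : c p q hpq σ = 0 := by
  obtain ⟨τ, rfl⟩ := hσ
  exact congrFun (congrFun (congrFun (congrFun hc p) q) hpq) τ

theorem coboundary_add (c d : Cochain Simp V n) :
    coboundary face (c + d) = coboundary face c + coboundary face d := by
  ext p q hpq σ
  cases p with
  | zero => exact (add_zero 0).symm
  | succ p =>
    exact (Finset.sum_congr rfl fun i _ => smul_add _ _ _).trans Finset.sum_add_distrib

theorem coboundary_sub (c d : Cochain Simp V n) :
    coboundary face (c - d) = coboundary face c - coboundary face d :=
  eq_sub_of_add_eq <| by rw [← coboundary_add, sub_add_cancel]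

theorem coboundary_cast {m : ℤ} (hmn : m = n) (c : Cochain Simp V m) :
    coboundary face (c.cast hmn) = (coboundary face c).cast (congrArg (· + 1) hmn) := by
  subst hmn
  rfl

theorem coboundary_comap {φ : ∀ p, Simp' p → Simp p}
    (hφ : ∀ p i σ, φ p (face' p i σ) = face p i (φ (p + 1) σ)) (c : Cochain Simp V n) :
    coboundary face' (c.comap φ) = (coboundary face c).comap φ := by
  ext p q hpq σ
  cases p with
  | zero => rfl
  | succ p => exact Finset.sum_congr rfl fun i _ => by rw [Cochain.comap, hφ]

theorem coboundary_coboundary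
    (hface : ∀ (p : ℕ) (i : Fin (p + 3)) (j : Fin (p + 2)) (σ : Simp (p + 2)),
      face p j (face (p + 1) i σ) = face p (j.predAbove i) (face (p + 1) (i.succAbove j) σ))
    (c : Cochain Simp V n) : coboundary face (coboundary face c) = 0 := by
  ext p q hpq σ
  match p with
  | 0 => rfl
  | 1 => exact Finset.sum_eq_zero fun i _ => smul_zero _
  | p + 2 =>
    change ∑ i : Fin (p + 3), (-1 : ℤ) ^ (i : ℕ) • ∑ j : Fin (p + 2), (-1 : ℤ) ^ (j : ℕ) •
      c p q _ (face p j (face (p + 1) i σ)) = 0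
    simp only [Finset.smul_sum, smul_smul, ← pow_add]
    exact sum_sum_neg_one_pow_eq_zero _ fun i j => by rw [hface]

/-- The combinatorics of the prisms over simplices that are moved by a homotopy: the prism over a
`p`-simplex `σ` consists of `p + 1` simplices, and `level j σ` are the `p`-simplices that separate
them, from the start `level 0 σ` to the end `level (Fin.last _) σ` of the homotopy. The remaining
faces form the prisms over the faces of `σ`. -/
structure FaceHomotopy (face : ∀ p : ℕ, Fin (p + 2) → Simp (p + 1) → Simp p) where
  /-- The simplices of the prism. -/
  prism (p : ℕ) : Fin (p + 1) → Simp p → Simp (p + 1)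
  /-- The simplices which separate those of the prism. -/
  level (p : ℕ) : Fin (p + 2) → Simp p → Simp p
  face_castSucc_prism : ∀ p i σ, face p i.castSucc (prism p i σ) = level p i.castSucc σ
  face_succ_prism : ∀ p i σ, face p i.succ (prism p i σ) = level p i.succ σ
  face_succAbove_prism : ∀ (p : ℕ) (y : Fin (p + 2)) (i : Fin (p + 1)) σ,
    face (p + 1) ((y.succAbove i).castSucc.succAbove y) (prism (p + 1) (y.succAbove i) σ) =
      prism p i (face p y σ)

namespace FaceHomotopy

/-- The prism operator. -/
def prismOperator (P : FaceHomotopy face) (c : Cochain Simp V (n + 1)) : Cochain Simp V n :=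
  fun p q hpq σ => ∑ i : Fin (p + 1), (-1 : ℤ) ^ (i : ℕ) •
    c (p + 1) q (by push_cast; omega) (P.prism p i σ)

theorem prismOperator_coboundary_apply (P : FaceHomotopy face) (c : Cochain Simp V n) (p : ℕ)
    (q : ℤ) (hpq : (p : ℤ) + q = n) (σ : Simp p) :
    P.prismOperator (coboundary face c) p q hpq σ =
      c p q hpq (P.level p 0 σ) - c p q hpq (P.level p (Fin.last (p + 1)) σ) -
        ∑ y : Fin (p + 1), ∑ i : Fin p, (-1 : ℤ) ^ (i + y : ℕ) • c p q hpq
          (face p ((y.succAbove i).castSucc.succAbove y) (P.prism p (y.succAbove i) σ)) := by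
  change ∑ i : Fin (p + 1), (-1 : ℤ) ^ (i : ℕ) • ∑ y : Fin (p + 2), (-1 : ℤ) ^ (y : ℕ) •
    c p q _ (face p y (P.prism p i σ)) = _
  simp only [Finset.smul_sum, smul_smul, ← pow_add]
  rw [sum_sum_neg_one_pow_prism fun i y => c p q hpq (face p y (P.prism p i σ))]
  simp only [P.face_castSucc_prism, P.face_succ_prism]
  rw [sum_castSucc_sub_succ fun j => c p q hpq (P.level p j σ)]

theorem coboundary_prismOperator_add (P : FaceHomotopy face) (c : Cochain Simp V (n + 1)) :
    coboundary face (P.prismOperator c) + P.prismOperator (coboundary face c) =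
      c.comap (fun p => P.level p 0) - c.comap fun p => P.level p (Fin.last (p + 1)) := by
  ext p q hpq σ
  rw [Cochain.add_apply, prismOperator_coboundary_apply]
  cases p with
  | zero =>
    refine (zero_add _).trans ((congrArg _ (Finset.sum_eq_zero fun y _ => ?_)).trans (sub_zero _))
    exact Finset.sum_empty
  | succ p =>
    have hface : coboundary face (P.prismOperator c) (p + 1) q hpq σ =
        ∑ y : Fin (p + 2), ∑ i : Fin (p + 1), (-1 : ℤ) ^ (i + y : ℕ) •
          c (p + 1) q hpq (P.prism p i (face p y σ)) := by
      change ∑ y : Fin (p + 2), (-1 : ℤ) ^ (y : ℕ) • ∑ i : Fin (p + 1), (-1 : ℤ) ^ (i : ℕ) •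
        c (p + 1) q _ (P.prism p i (face p y σ)) = _
      simp only [Finset.smul_sum, smul_smul, ← pow_add, add_comm]
    simp only [hface, P.face_succAbove_prism]
    exact add_sub_cancel _ _

theorem coboundary_prismOperator_eq_self (P : FaceHomotopy face) {r : Cochain Simp V (n + 1)}
    (hr : coboundary face r = 0) (hzero : ∀ p σ, P.level p 0 σ = σ)
    (hlast : r.comap (fun p => P.level p (Fin.last (p + 1))) = 0) :
    coboundary face (P.prismOperator r) = r := by
  have hP : P.prismOperator (coboundary face r) = 0 := by
    rw [hr]
    exact Cochain.ext fun p q hpq σ => Finset.sum_eq_zero fun i _ => smul_zero _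
  have hr₀ : r.comap (fun p => P.level p 0) = r := Cochain.ext fun p q hpq σ => by
    rw [Cochain.comap, hzero]
  simpa only [hP, hr₀, hlast, add_zero, sub_zero] using P.coboundary_prismOperator_add r

theorem comap_prismOperator_eq_zero (P : FaceHomotopy face) {ι : ∀ p, Simp' p → Simp p}
    (hprism : ∀ p i σ, P.prism p i (ι p σ) ∈ range (ι (p + 1))) {r : Cochain Simp V (n + 1)}
    (hr : r.comap ι = 0) : (P.prismOperator r).comap ι = 0 := by
  ext p q hpq σ
  rw [Cochain.comap, prismOperator]
  refine Finset.sum_eq_zero fun i _ => ?_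
  rw [Cochain.apply_eq_zero_of_mem_range hr _ (hprism p i σ), smul_zero]

theorem exists_extension (P : FaceHomotopy face) {ι : ∀ p, Simp' p → Simp p}
    (hι : ∀ p, Function.Injective (ι p))
    (hface : ∀ p i σ, ι p (face' p i σ) = face p i (ι (p + 1) σ))
    (hprism : ∀ p i σ, P.prism p i (ι p σ) ∈ range (ι (p + 1)))
    (hzero : ∀ p σ, P.level p 0 σ = σ)
    (hlast : ∀ p σ, P.level p (Fin.last (p + 1)) σ ∈ range (ι p))
    (hδδ : ∀ e : Cochain Simp V n, coboundary face (coboundary face e) = 0)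
    {c : Cochain Simp V (n + 1)} (hc : coboundary face c = 0) {h : Cochain Simp' V n}
    (hh : coboundary face' h = c.comap ι) :
    ∃ h' : Cochain Simp V n, coboundary face h' = c ∧ h'.comap ι = h := by
  let e : Cochain Simp V n := fun p q hpq => Function.extend (ι p) (h p q hpq) 0
  have he : e.comap ι = h := Cochain.ext fun p q hpq σ => (hι p).extend_apply _ _ _
  let r := c - coboundary face e
  have hδr : coboundary face r = 0 := by rw [coboundary_sub, hc, hδδ, sub_zero]
  have hιr : r.comap ι = 0 := by
    rw [Cochain.comap_sub, ← coboundary_comap hface, he, hh, sub_self]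
  have hr : coboundary face (P.prismOperator r) = r :=
    P.coboundary_prismOperator_eq_self hδr hzero <| Cochain.ext fun p q hpq σ =>
      Cochain.apply_eq_zero_of_mem_range hιr hpq (hlast p σ)
  refine ⟨e + P.prismOperator r, by rw [coboundary_add, hr, add_sub_cancel], ?_⟩
  rw [Cochain.comap_add, he, P.comap_prismOperator_eq_zero hprism hιr, add_zero]

end FaceHomotopy

end Cochains

/-! ### Affine maps of standard simplices -/

section Simplices

variable {p r : ℕ}

theorem tail_mem_corner {v : Fin (p + 1) → ℝ} (hv : v ∈ stdSimplex ℝ (Fin (p + 1))) :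
    Fin.tail v ∈ corner p := by
  refine ⟨fun j => hv.1 j.succ, ?_⟩
  rw [← hv.2, Fin.sum_univ_succ]
  exact le_add_of_nonneg_left (hv.1 0)

theorem baryVec_tail {v : Fin (p + 1) → ℝ} (hv : v ∈ stdSimplex ℝ (Fin (p + 1))) :
    baryVec (Fin.tail v) = v := by
  have hv₀ : 1 - ∑ j, Fin.tail v j = v 0 := by
    rw [← hv.2, Fin.sum_univ_succ]
    exact add_sub_cancel_right _ _
  rw [baryVec, hv₀]
  exact Fin.cons_self_tail v

theorem contDiff_baryVec : ContDiff ℝ ∞ (baryVec : (Fin p → ℝ) → Fin (p + 1) → ℝ) := by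
  refine contDiff_pi.2 (Fin.cases ?_ fun j => contDiff_apply ℝ ℝ j)
  simp only [baryVec, Fin.cons_zero]
  fun_prop

/-- The affine map of standard simplices with the map `g` of vertices, in Cartesian coordinates. -/
noncomputable def cornerMap (g : Fin (p + 1) → Fin (r + 1)) (t : Fin p → ℝ) : Fin r → ℝ :=
  Fin.tail (FunOnFinite.linearMap ℝ ℝ g (baryVec t))

theorem contDiff_cornerMap (g : Fin (p + 1) → Fin (r + 1)) : ContDiff ℝ ∞ (cornerMap g) :=
  contDiff_pi.2 fun j => (contDiff_apply ℝ ℝ j.succ).comp <|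
    (FunOnFinite.linearMap ℝ ℝ g).toContinuousLinearMap.contDiff.comp contDiff_baryVec

theorem cornerMap_mem (g : Fin (p + 1) → Fin (r + 1)) :
    MapsTo (cornerMap g) (corner p) (corner r) :=
  fun _ ht => tail_mem_corner (stdSimplex.map g ⟨_, baryVec_mem ht⟩).2

theorem map_bary (g : Fin (p + 1) → Fin (r + 1)) {t : Fin p → ℝ} (ht : t ∈ corner p) :
    stdSimplex.map g (bary p t) = bary r (cornerMap g t) := by
  rw [bary_of_mem ht, bary_of_mem (cornerMap_mem g ht)]
  exact Subtype.ext (baryVec_tail (stdSimplex.map g ⟨_, baryVec_mem ht⟩).2).symm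

/-- The affine function on the standard simplex with the values `q m ∈ {0, 1}` at the vertices. -/
noncomputable def weight (q : Fin (p + 1) → Fin 2) (z : stdSimplex ℝ (Fin (p + 1))) : ℝ :=
  stdSimplex.map q z 1

theorem weight_mem (q : Fin (p + 1) → Fin 2) (z : stdSimplex ℝ (Fin (p + 1))) :
    weight q z ∈ Icc (0 : ℝ) 1 := ⟨stdSimplex.zero_le _ _, stdSimplex.le_one _ _⟩

theorem weight_map (g : Fin (p + 1) → Fin (r + 1)) (q : Fin (r + 1) → Fin 2)
    (z : stdSimplex ℝ (Fin (p + 1))) : weight q (stdSimplex.map g z) = weight (q ∘ g) z :=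
  congrArg (· 1) (stdSimplex.map_comp_apply g q z)

theorem weight_zero (z : stdSimplex ℝ (Fin (p + 1))) : weight 0 z = 0 := by
  simp [weight, FunOnFinite.linearMap_apply_apply]

theorem weight_one (z : stdSimplex ℝ (Fin (p + 1))) : weight 1 z = 1 := by
  simp [weight, FunOnFinite.linearMap_apply_apply]

theorem continuous_weight (q : Fin (p + 1) → Fin 2) : Continuous (weight q) :=
  (continuous_apply 1).comp (continuous_subtype_val.comp (stdSimplex.continuous_map q))

theorem contDiffOn_weight_bary (q : Fin (p + 1) → Fin 2) :
    ContDiffOn ℝ ∞ (fun t => weight q (bary p t)) (corner p) := by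
  refine (contDiff_pi.1 (contDiff_cornerMap (r := 1) q) 0).contDiffOn.congr fun t ht => ?_
  rw [weight, map_bary (r := 1) q ht, bary_of_mem (cornerMap_mem q ht)]
  rfl

end Simplices

/-! ### The contraction of the last coordinate -/

section Shrink

variable {M : Type*} {k : ℕ}

/-- The contraction of the last coordinate by the factor `s`. -/
def shrink (s : ℝ) (x : M × (Fin (k + 1) → ℝ)) : M × (Fin (k + 1) → ℝ) :=
  (x.1, Fin.snoc (Fin.init x.2) (s * x.2 (Fin.last k)))

theorem shrink_one (x : M × (Fin (k + 1) → ℝ)) : shrink 1 x = x := by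
  rw [shrink, one_mul, Fin.snoc_init_self]

/-- The sets to which the contraction of the last coordinate restricts. -/
def IsShrinkable (S : Set (M × (Fin (k + 1) → ℝ))) : Prop :=
  ∀ s ∈ Icc (0 : ℝ) 1, MapsTo (shrink s) S S

variable {X A : Set (M × (Fin k → ℝ))}

theorem isShrinkable_prodI : IsShrinkable (prodI X) := fun s hs x hx => by
  simpa only [prodI, shrink, mem_ofPred_eq, Fin.init_snoc, Fin.snoc_last] using
    And.intro hx.1 (unitInterval.mul_mem hs hx.2)

theorem isShrinkable_cyl : IsShrinkable (cyl X A) := fun s hs x hx => by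
  simp only [cyl, shrink, mem_ofPred_eq, Fin.init_snoc, Fin.snoc_last]
  exact hx.imp (And.imp_right fun h0 => by rw [h0, mul_zero])
    (And.imp_right fun h1 => unitInterval.mul_mem hs h1)

theorem mapsTo_shrink_zero_prodI : MapsTo (shrink 0) (prodI X) (cyl X A) := fun x hx => by
  simp only [cyl, shrink, mem_ofPred_eq, Fin.init_snoc, Fin.snoc_last, zero_mul, and_true]
  exact Or.inl hx.1

end Shrink

/-! ### Prisms of smooth simplices -/

theorem val_succAbove {n : ℕ} (i : Fin (n + 1)) (m : Fin n) :
    (i.succAbove m : ℕ) = if (m : ℕ) < i then (m : ℕ) else m + 1 := by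
  simp only [Fin.succAbove, Fin.lt_def, Fin.val_castSucc]
  split_ifs <;> rfl

theorem val_predAbove {n : ℕ} (i : Fin n) (m : Fin (n + 1)) :
    (i.predAbove m : ℕ) = if (i : ℕ) < m then (m : ℕ) - 1 else m := by
  simp only [Fin.predAbove, Fin.lt_def, Fin.val_castSucc]
  split_ifs <;> rfl

section SmoothSimplices

variable {E : Type*} [NormedAddCommGroup E] [NormedSpace ℝ E] {H : Type*} [TopologicalSpace H]
  {I : ModelWithCorners ℝ E H} {M : Type*} [TopologicalSpace M] [ChartedSpace H M] {k p r : ℕ}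

theorem SmoothSimplex.ext_val {S : Set (M × (Fin k → ℝ))} {σ τ : SmoothSimplex I S p}
    (h : ∀ z, (σ.toMap z).1 = (τ.toMap z).1) : σ = τ :=
  SmoothSimplex.ext (ContinuousMap.ext fun z => Subtype.ext (h z))

theorem SmoothSimplex.incl_injective {S T : Set (M × (Fin k → ℝ))} (hST : S ⊆ T) (p : ℕ) :
    Function.Injective (SmoothSimplex.incl I hST (p := p)) := fun _ _ h =>
  SmoothSimplex.ext_val fun z => congrArg (fun ρ : SmoothSimplex I T p => (ρ.toMap z).1) h

theorem SmoothSimplex.mem_range_incl {S T : Set (M × (Fin k → ℝ))} (hST : S ⊆ T)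
    {σ : SmoothSimplex I T p} (hσ : ∀ z, (σ.toMap z).1 ∈ S) :
    σ ∈ range (SmoothSimplex.incl I hST (p := p)) :=
  ⟨⟨⟨fun z => ⟨(σ.toMap z).1, hσ z⟩,
    (continuous_subtype_val.comp σ.toMap.continuous).subtype_mk hσ⟩, σ.smooth_fst, σ.smooth_snd⟩,
    rfl⟩

theorem smoothFace_smoothFace (S : Set (M × (Fin k → ℝ))) (p : ℕ) (i : Fin (p + 3))
    (j : Fin (p + 2)) (σ : SmoothSimplex I S (p + 2)) :
    smoothFace I S p j (smoothFace I S (p + 1) i σ) =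
      smoothFace I S p (j.predAbove i) (smoothFace I S (p + 1) (i.succAbove j) σ) := by
  refine SmoothSimplex.ext_val fun z => congrArg (fun w => (σ.toMap w).1) ?_
  change stdSimplex.map i.succAbove (stdSimplex.map j.succAbove z) =
    stdSimplex.map (i.succAbove j).succAbove (stdSimplex.map (j.predAbove i).succAbove z)
  rw [stdSimplex.map_comp_apply, stdSimplex.map_comp_apply]
  refine congrArg (stdSimplex.map · z) (funext fun m => ?_)
  exact (Fin.succAbove_succAbove_succAbove_predAbove i j m).symm

theorem coboundary_smoothFace_coboundary {S : Set (M × (Fin k → ℝ))} {V : ℤ → Type*}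
    [∀ q, AddCommGroup (V q)] {n : ℤ} (c : SmoothCochain I S V n) :
    coboundary (smoothFace I S) (coboundary (smoothFace I S) c) = 0 :=
  coboundary_coboundary (smoothFace_smoothFace S) c

variable {S T : Set (M × (Fin (k + 1) → ℝ))}

/-- The smooth simplex `z ↦ shrink (weight q z) (σ (g z))`: the image of the simplex of the prism
over `σ` with the vertices `(g m, q m)`, under the contraction of the last coordinate. -/
noncomputable def SmoothSimplex.shrinkMap (hS : IsShrinkable S) (g : Fin (p + 1) → Fin (r + 1))
    (q : Fin (p + 1) → Fin 2) (σ : SmoothSimplex I S r) : SmoothSimplex I S p where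
  toMap := ⟨fun z => ⟨shrink (weight q z) (σ.toMap (stdSimplex.map g z)).1,
    hS _ (weight_mem q z) (σ.toMap _).2⟩, by
    have hσ : Continuous fun z => (σ.toMap (stdSimplex.map g z)).1 :=
      continuous_subtype_val.comp (σ.toMap.continuous.comp (stdSimplex.continuous_map g))
    exact (hσ.fst.prodMk (Continuous.finSnoc (A := fun _ => ℝ) hσ.snd.finInit
      ((continuous_weight q).mul ((continuous_apply _).comp hσ.snd)))).subtype_mk _⟩
  smooth_fst := by
    refine (σ.smooth_fst.comp (contDiff_cornerMap g).contMDiff.contMDiffOn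
      (cornerMap_mem g)).congr fun t ht => ?_
    exact congrArg (fun z => (σ.toMap z).1.1) (map_bary g ht)
  smooth_snd := by
    have hσ : ContDiffOn ℝ ∞ (fun t => (σ.toMap (stdSimplex.map g (bary p t))).1.2) (corner p) :=
      (σ.smooth_snd.comp (contDiff_cornerMap g).contDiffOn (cornerMap_mem g)).congr
        fun t ht => congrArg (fun z => (σ.toMap z).1.2) (map_bary g ht)
    refine contDiffOn_pi.2 (Fin.lastCases ?_ fun l => ?_)
    · simpa only [ContinuousMap.coe_mk, shrink, Fin.snoc_last] using
        (contDiffOn_weight_bary q).mul (contDiffOn_pi.1 hσ (Fin.last k))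
    · simpa only [ContinuousMap.coe_mk, shrink, Fin.snoc_castSucc, Fin.init] using
        contDiffOn_pi.1 hσ l.castSucc

theorem smoothFace_shrinkMap (hS : IsShrinkable S) (i : Fin (p + 2))
    (g : Fin (p + 2) → Fin (r + 1)) (q : Fin (p + 2) → Fin 2) (σ : SmoothSimplex I S r) :
    smoothFace I S p i (σ.shrinkMap hS g q) =
      σ.shrinkMap hS (g ∘ i.succAbove) (q ∘ i.succAbove) := by
  refine SmoothSimplex.ext_val fun z => congrArg₂ shrink (weight_map _ q z) ?_
  exact congrArg (fun w => (σ.toMap w).1) (stdSimplex.map_comp_apply _ g z)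

theorem shrinkMap_smoothFace (hS : IsShrinkable S) (g : Fin (p + 1) → Fin (r + 1))
    (q : Fin (p + 1) → Fin 2) (i : Fin (r + 2)) (σ : SmoothSimplex I S (r + 1)) :
    (smoothFace I S r i σ).shrinkMap hS g q = σ.shrinkMap hS (i.succAbove ∘ g) q :=
  SmoothSimplex.ext_val fun z => congrArg (fun w => shrink (weight q z) (σ.toMap w).1)
    (stdSimplex.map_comp_apply g _ z)

theorem shrinkMap_id_one (hS : IsShrinkable S) (σ : SmoothSimplex I S p) :
    σ.shrinkMap hS id 1 = σ := by
  refine SmoothSimplex.ext_val fun z => ?_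
  change shrink (weight 1 z) (σ.toMap (stdSimplex.map id z)).1 = _
  rw [weight_one, shrink_one, stdSimplex.map_id_apply]

theorem shrinkMap_mem_range_incl (hS : IsShrinkable S) (hT : IsShrinkable T) (hTS : T ⊆ S)
    (g : Fin (p + 1) → Fin (r + 1)) (q : Fin (p + 1) → Fin 2) (σ : SmoothSimplex I T r) :
    (σ.incl I hTS).shrinkMap hS g q ∈ range (SmoothSimplex.incl I hTS) :=
  ⟨σ.shrinkMap hT g q, rfl⟩

theorem shrinkMap_zero_mem_range_incl (hS : IsShrinkable S) (hTS : T ⊆ S)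
    (hST : MapsTo (shrink 0) S T) (g : Fin (p + 1) → Fin (r + 1)) (σ : SmoothSimplex I S r) :
    σ.shrinkMap hS g 0 ∈ range (SmoothSimplex.incl I hTS) :=
  SmoothSimplex.mem_range_incl hTS fun z => by
    change shrink (weight 0 z) _ ∈ T
    rw [weight_zero]
    exact hST (σ.toMap _).2

/-- The homotopy which contracts the last coordinate. -/
noncomputable def shrinkHomotopy (hS : IsShrinkable S) : FaceHomotopy (smoothFace I S) where
  prism p i σ := σ.shrinkMap hS i.predAbove fun m => if m ≤ i.castSucc then 0 else 1
  level p j σ := σ.shrinkMap hS id fun m => if m.castSucc < j then 0 else 1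
  face_castSucc_prism p i σ := by
    rw [smoothFace_shrinkMap]
    congr 1
    · exact funext fun m => Fin.predAbove_succAbove i m
    · funext m
      simp only [Function.comp_apply, Fin.le_def, Fin.lt_def, val_succAbove, Fin.val_castSucc]
      grind
  face_succ_prism p i σ := by
    rw [smoothFace_shrinkMap]
    congr 1
    · funext m
      simp only [Function.comp_apply, Fin.ext_iff, val_predAbove, val_succAbove, Fin.val_succ]
      grind
    · funext m
      simp only [Function.comp_apply, Fin.le_def, Fin.lt_def, val_succAbove, Fin.val_castSucc,
        Fin.val_succ]
      grind
  face_succAbove_prism p y i σ := by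
    rw [smoothFace_shrinkMap, shrinkMap_smoothFace]
    congr 1
    · funext m
      simp only [Function.comp_apply, Fin.ext_iff, val_predAbove, val_succAbove, Fin.val_castSucc]
      grind
    · funext m
      simp only [Function.comp_apply, Fin.le_def, val_succAbove, Fin.val_castSucc]
      grind

theorem shrinkHomotopy_level_zero (hS : IsShrinkable S) (σ : SmoothSimplex I S p) :
    (shrinkHomotopy hS).level p 0 σ = σ :=
  shrinkMap_id_one hS σ

theorem shrinkHomotopy_level_last (hS : IsShrinkable S) (σ : SmoothSimplex I S p) :
    (shrinkHomotopy hS).level p (Fin.last (p + 1)) σ = σ.shrinkMap hS id 0 :=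
  congrArg (σ.shrinkMap hS id ·) (funext fun m => if_pos (Fin.castSucc_lt_last m))

end SmoothSimplices

/-! ### Extension of differential functions -/

section DifferentialFunctions

variable {E : Type*} [NormedAddCommGroup E] [NormedSpace ℝ E] {H : Type*} [TopologicalSpace H]
  {I : ModelWithCorners ℝ E H} {M : Type*} [TopologicalSpace M] [ChartedSpace H M] {k : ℕ}
  {Y : Type*} [TopologicalSpace Y] {V : ℤ → Type*} [∀ q, AddCommGroup (V q)] {n : ℤ}
  {κ : SingularCochain Y V n}

theorem coboundary_pullbackCochain (hκ : IsSingularCocycle κ) {S : Set (M × (Fin k → ℝ))}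
    (f : C(S, Y)) : coboundary (smoothFace I S) (pullbackCochain I f κ) = 0 :=
  (coboundary_comap (face := singularFace Y)
    (φ := fun _ (σ : SmoothSimplex I S _) => f.comp σ.toMap) (fun _ _ _ => rfl) κ).trans
    (congrArg (Cochain.comap _) (Cochain.ext hκ))

variable [FiniteDimensional ℝ E] [∀ q, Module ℝ (V q)]

theorem DifferentialFunction.cast_coboundary_h {S : Set (M × (Fin k → ℝ))}
    (D : DifferentialFunction I S κ) :
    (coboundary (smoothFace I S) D.h).cast (sub_add_cancel n 1) =
      chi I S D.curv - pullbackCochain I D.f κ :=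
  Cochain.ext D.coboundary_eq

theorem DifferentialFunction.coboundary_chi (hκ : IsSingularCocycle κ)
    {S : Set (M × (Fin k → ℝ))} (D : DifferentialFunction I S κ) :
    coboundary (smoothFace I S) (chi I S D.curv) = 0 := by
  rw [eq_add_of_sub_eq D.cast_coboundary_h.symm, coboundary_add, coboundary_pullbackCochain hκ,
    add_zero, coboundary_cast, coboundary_smoothFace_coboundary]
  rfl

variable {S T : Set (M × (Fin (k + 1) → ℝ))}

theorem chi_comap_shrinkMap_id (hS : IsShrinkable S) (q : ∀ p, Fin (p + 1) → Fin 2)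
    (η : ClosedGradedForm I M V n) :
    (chi I S η).comap (fun p => SmoothSimplex.shrinkMap hS id (q p)) = chi I S η := by
  ext p q hpq σ
  change integralForm I (η p q hpq) (fun z => (σ.toMap (stdSimplex.map id z)).1.1) = _
  simp only [stdSimplex.map_id_apply]
  rfl

theorem coboundary_chi_eq_zero_of_subset (hS : IsShrinkable S) (hTS : T ⊆ S)
    (hST : MapsTo (shrink 0) S T) {η : ClosedGradedForm I M V n}
    (hη : coboundary (smoothFace I T) (chi I T η) = 0) :
    coboundary (smoothFace I S) (chi I S η) = 0 := by
  have hι : (coboundary (smoothFace I S) (chi I S η)).comap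
      (fun p => SmoothSimplex.incl I hTS (p := p)) = 0 :=
    (coboundary_comap (face := smoothFace I S) (fun _ _ _ => rfl) _).symm.trans hη
  rw [← chi_comap_shrinkMap_id hS fun _ => 0, coboundary_comap fun p i σ =>
    (shrinkMap_smoothFace hS id 0 i σ).trans (smoothFace_shrinkMap hS i id 0 σ).symm]
  exact Cochain.ext fun p q hpq σ => Cochain.apply_eq_zero_of_mem_range hι hpq
    (shrinkMap_zero_mem_range_incl hS hTS hST id σ)

theorem DifferentialFunction.exists_extension (hκ : IsSingularCocycle κ) (hS : IsShrinkable S)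
    (hT : IsShrinkable T) (hTS : T ⊆ S) (hST : MapsTo (shrink 0) S T)
    (D : DifferentialFunction I T κ) {F : C(S, Y)} (hF : ∀ x, F (inclusion hTS x) = D.f x) :
    ∃ G : DifferentialFunction I S κ, G.f = F ∧
      G.h.comap (fun _ => SmoothSimplex.incl I hTS) = D.h ∧ G.curv = D.curv := by
  let c := (chi I S D.curv - pullbackCochain I F κ).cast (sub_add_cancel n 1).symm
  have hc : coboundary (smoothFace I S) c = 0 := by
    rw [coboundary_cast, coboundary_sub, coboundary_pullbackCochain hκ, sub_zero,
      coboundary_chi_eq_zero_of_subset hS hTS hST (D.coboundary_chi hκ)]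
    rfl
  have hcD : coboundary (smoothFace I T) D.h = c.comap fun _ => SmoothSimplex.incl I hTS := by
    have hf : D.f = F.comp (ContinuousMap.inclusion hTS) :=
      ContinuousMap.ext fun x => (hF x).symm
    have hD := congrArg (Cochain.cast (sub_add_cancel n 1).symm) D.cast_coboundary_h
    rw [hf] at hD
    exact hD
  obtain ⟨h, hh, hhD⟩ := (shrinkHomotopy hS).exists_extension (SmoothSimplex.incl_injective hTS)
    (fun _ _ _ => rfl) (fun _ _ => shrinkMap_mem_range_incl hS hT hTS _ _)
    (fun _ => shrinkHomotopy_level_zero hS)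
    (fun _ σ => shrinkHomotopy_level_last hS σ ▸ shrinkMap_zero_mem_range_incl hS hTS hST id σ)
    coboundary_smoothFace_coboundary hc hcD
  refine ⟨⟨F, h, D.curv, fun p q hpq σ => ?_⟩, rfl, hhD, rfl⟩
  rw [hh]
  rfl

end DifferentialFunctions

end DiffHEP

theorem lemma4p1
    {E : Type*} [NormedAddCommGroup E] [NormedSpace ℝ E] [FiniteDimensional ℝ E]
    {H : Type*} [TopologicalSpace H] (I : ModelWithCorners ℝ E H)
    (hI : DiffHEP.IsBoundaryModel I)
    {M : Type*} [TopologicalSpace M] [ChartedSpace H M] [IsManifold I ∞ M]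
    [T2Space M] [SecondCountableTopology M]
    {Y : Type*} [TopologicalSpace Y]
    {V : ℤ → Type*} [∀ q, AddCommGroup (V q)] [∀ q, Module ℝ (V q)]
    {n : ℤ} (κ : DiffHEP.SingularCochain Y V n) (hκ : DiffHEP.IsSingularCocycle κ)
    {k : ℕ} (X A : Set (M × (Fin k → ℝ)))
    (hX : DiffHEP.IsManifoldWithCylinders I k X)
    (hA : DiffHEP.IsManifoldWithCylinders I k A) (hAX : A ⊆ X)
    (D : DiffHEP.DifferentialFunction I (DiffHEP.cyl X A) κ) :
    ∃ G : DiffHEP.DifferentialFunction I (DiffHEP.prodI X) κ,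
      (∀ x : DiffHEP.cyl X A,
        G.f (Set.inclusion (DiffHEP.cyl_subset_prodI hAX) x) = D.f x) ∧
      (∀ (p : ℕ) (q : ℤ) (hpq : (p : ℤ) + q = n - 1)
        (σ : DiffHEP.SmoothSimplex I (DiffHEP.cyl X A) p),
        G.h p q hpq (σ.incl I (DiffHEP.cyl_subset_prodI hAX)) = D.h p q hpq σ) ∧
      G.curv = D.curv := by
  obtain ⟨F, hF⟩ := DiffHEP.exists_continuousMap_extension hI hX hA hAX D.f
  obtain ⟨G, rfl, hh, hcurv⟩ := D.exists_extension hκ DiffHEP.isShrinkable_prodI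
    DiffHEP.isShrinkable_cyl (DiffHEP.cyl_subset_prodI hAX) DiffHEP.mapsTo_shrink_zero_prodI hF
  exact ⟨G, hF, fun p q hpq σ => congrFun (congrFun (congrFun (congrFun hh p) q) hpq) σ, hcurv⟩
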